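/- Let $k$ be a field of characteristic $p>0$ and let $X$ be a compact connected CW-complex with fundamental group $\Gamma=\pi_1(X,x_0)$. Let $(\Gamma_i)_{i\ge 0}$ be a residual $p$-chain in $\Gamma$, that is, a descending sequence $\Gamma_0\supseteq\Gamma_1\supseteq\cdots$ of normal subgroups of $\Gamma$ such that each index $[\Gamma:\Gamma_i]$ is a power of $p$ and $\bigcap_{i\ge 0}\Gamma_i=\{1\}$. For each $i$ let $X_i\to X$ be the finite (connected) covering associated to $\Gamma_i$. Then for every $n\ge 0$ the homology groups $H_n(X_i;k)$ are finite-dimensional over $k$ and, with $b_n(X_i;k)=\dim_k H_n(X_i;k)$, the sequence of normalized Betti numbers $$\Bigl(\frac{b_n(X_i;k)}{[\Gamma:\Gamma_i]}\Bigr)_{i\ge 0}$$ is monotone decreasing (in the weak sense) and converges to a real number as $i\to\infty$. -/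

import Mathlib

noncomputable section

namespace PTower

open CategoryTheory

universe u v w

/-- A residual `p`-chain in a group `G`: a descending sequence of normal subgroups of `G` whose
indices in `G` are (finite) powers of `p` and whose intersection is trivial. -/
structure IsResidualPChain (p : ℕ) {G : Type u} [Group G] (Γ : ℕ → Subgroup G) : Prop where
  antitone : Antitone Γ
  normal : ∀ i, (Γ i).Normal
  index_eq_pow : ∀ i, ∃ m : ℕ, (Γ i).index = p ^ m
  iInf_eq_bot : ⨅ i, Γ i = ⊥

/-- `q : E → X` is the (path-connected) covering of `X` associated to the subgroup `H` of
`π₁(X, x₀)`: for some point `e₀` above `x₀`, the image of `π₁(E, e₀)` under `q` is `H`. -/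
structure IsCoverAssociatedTo {E : Type w} {X : Type u} [TopologicalSpace E] [TopologicalSpace X]
    (q : C(E, X)) {x₀ : X} (H : Subgroup (FundamentalGroup X x₀)) : Prop where
  isCoveringMap : IsCoveringMap q
  pathConnectedSpace : PathConnectedSpace E
  exists_range_eq : ∃ (e₀ : E) (he : q e₀ = x₀), (FundamentalGroup.mapOfEq q he).range = H

/-- The `n`-th singular homology `H_n(Y; k)` of the space `Y` with coefficients in `k`.
(`ULift k` is just `k`, moved to a universe that accommodates both `k` and `Y`.) -/
def homology (k : Type v) [Field k] (n : ℕ) (Y : Type w) [TopologicalSpace Y] :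
    ModuleCat.{max v w} k :=
  ((AlgebraicTopology.singularHomologyFunctor (ModuleCat.{max v w} k) n).obj
    (ModuleCat.of k (ULift.{w} k))).obj (TopCat.of Y)

/-- The `n`-th Betti number `b_n(Y; k) = dim_k H_n(Y; k)`. -/
def bettiNumber (k : Type v) [Field k] (n : ℕ) (Y : Type w) [TopologicalSpace Y] : ℕ :=
  Module.finrank k (homology k n Y)

end PTower

end

noncomputable section

namespace PTower

open CategoryTheory

universe u v w

/-! ### Alternating sums and homology of a sequence of linear maps -/

section AlternatingSum

variable {k A B C : Type*} [CommRing k] [AddCommGroup A] [Module k A] [AddCommGroup B] [Module k B]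
  [AddCommGroup C] [Module k C]

/-! Two facts carry the proof. First, if `K' ≤ K` are the subgroups of two covers `E'`, `E` of `X`,
with `K'` normal and `K/K'` a finite `p`-group, then dim H_n(E'; k) ≤ [K : K'] · dim H_n(E; k) as
soon as H_n(E; k) is finite-dimensional. Second, H_n(X; k) is finite-dimensional. The argument for
the first fact, applied to a cover of `X` itself, also makes the homology of the covers
finite-dimensional. Dividing the inequality by the index in the fundamental group gives
monotonicity, and a decreasing sequence of nonnegative reals converges.

The inequality. Fix a path class from the base point to every point of `X`. A simplex of a cover is
determined by its projection and its initial vertex; monodromy along the fixed paths turns that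
vertex into a coset, so simplices of `E` are pairs of a simplex of `X` and a coset of `K`
(`exists_simplices_equiv`). Only the zeroth face moves the initial vertex, so only that face acts on
the coset. In these coordinates, and without any map from `E'` to `E`, the chains of `E'` become
chains of `E` with coefficients in k[G], G = K/K', the zeroth face being twisted by a cocycle. A
nonzero representation of a `p`-group in characteristic `p` has a nonzero fixed vector
(`exists_fixed_vector`), so k[G] is filtered with |G| trivial one-dimensional quotients, and
exactness of homology gives the bound (`finite_H_repD`).

Finiteness. A compact CW complex has finitely many cells, and attaching a cell preserves local
contractibility (`LocContr.union_image_closedBall`). Hence each point has arbitrarily small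
neighbourhoods whose inclusions have finite rank on homology. A Mayer–Vietoris argument with
shrinking neighbourhoods, resting on barycentric subdivision (`exists_eq_add_add_singularD`),
spreads this to neighbourhoods of compact sets (`exists_isOpen_finiteRank`), in particular to `X`,
whose identity map then has finite rank. -/

/-- The alternating sum of a finite family of linear maps. -/
def altSum {m : ℕ} (D : Fin m → A →ₗ[k] B) : A →ₗ[k] B := ∑ i : Fin m, (-1 : k) ^ (i : ℕ) • D i

theorem altSum_apply {m : ℕ} (D : Fin m → A →ₗ[k] B) (a : A) :
    altSum D a = ∑ i : Fin m, (-1 : k) ^ (i : ℕ) • D i a := by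
  simp [altSum]

/-- The terms cancel in pairs: (i, j) with i ≤ j is matched with (j + 1, i), which carries the
opposite sign. -/
theorem altSum_comp_altSum {m : ℕ} (D : Fin (m + 1) → B →ₗ[k] C) (D' : Fin (m + 2) → A →ₗ[k] B)
    (h : ∀ i j : Fin (m + 1), i ≤ j → D i ∘ₗ D' j.succ = D j ∘ₗ D' i.castSucc) :
    altSum D ∘ₗ altSum D' = 0 := by
  ext a
  simp only [LinearMap.comp_apply, altSum_apply, map_sum, map_smul, LinearMap.zero_apply,
    Finset.smul_sum, smul_smul]
  rw [← Finset.sum_product']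
  let S : Finset (Fin (m + 2) × Fin (m + 1)) := {ij | (ij.1 : ℕ) ≤ (ij.2 : ℕ)}
  rw [Finset.univ_product_univ, ← Finset.sum_add_sum_compl S, ← eq_neg_iff_add_eq_zero,
    ← Finset.sum_neg_distrib]
  let φ : ∀ ij : Fin (m + 2) × Fin (m + 1), ij ∈ S → Fin (m + 2) × Fin (m + 1) := fun ij hij =>
    (ij.2.succ, Fin.castLT ij.1 (lt_of_le_of_lt (Finset.mem_filter.mp hij).right (Fin.is_lt ij.2)))
  apply Finset.sum_bij φ
  · intro ij hij
    simp_rw [S, φ, Finset.compl_filter, Finset.mem_filter_univ, Fin.val_succ,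
      Fin.val_castLT] at hij ⊢
    lia
  · rintro ⟨i, j⟩ hij ⟨i', j'⟩ hij' e
    simp only [φ, Prod.mk.injEq, Fin.succ_inj] at e
    ext
    · simpa using congr_arg Fin.val e.2
    · simpa using congr_arg Fin.val e.1
  · rintro ⟨j', i'⟩ hij'
    simp_rw [S, Finset.compl_filter, Finset.mem_filter_univ, not_le] at hij'
    refine ⟨(Fin.castSucc i', j'.pred ?_), ?_, ?_⟩
    · rintro rfl
      simp only [Fin.val_zero, not_lt_zero] at hij'
    · simpa [S] using! Nat.le_sub_one_of_lt hij'
    · simp only [φ, Fin.castLT_castSucc, Fin.succ_pred]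
  · rintro ⟨i, j⟩ hij
    have hij' : (i : ℕ) ≤ j := by simpa [S] using hij
    have key := LinearMap.congr_fun
      (h (Fin.castLT i (by lia)) j (by simpa [Fin.le_def] using hij')) a
    simp only [LinearMap.comp_apply, Fin.castSucc_castLT] at key
    simp only [φ, Fin.val_succ, Fin.val_castLT, pow_succ, ← neg_smul, key]
    congr 1
    ring

end AlternatingSum

section Homology

variable {k : Type*} [Field k] {M : ℕ → Type*} [∀ n, AddCommGroup (M n)] [∀ n, Module k (M n)]

/-- The cycles of a sequence of linear maps `M (n + 1) → M n`. -/
def cycles (d : ∀ n, M (n + 1) →ₗ[k] M n) : ∀ n, Submodule k (M n)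
  | 0 => ⊤
  | n + 1 => LinearMap.ker (d n)

/-- The boundaries of a sequence of linear maps `M (n + 1) → M n`, as a submodule of the cycles. -/
def boundaries (d : ∀ n, M (n + 1) →ₗ[k] M n) (n : ℕ) : Submodule k (cycles d n) :=
  (LinearMap.range (d n)).submoduleOf (cycles d n)

/-- The homology of a sequence of linear maps `M (n + 1) → M n`. -/
abbrev H (d : ∀ n, M (n + 1) →ₗ[k] M n) (n : ℕ) : Type _ := cycles d n ⧸ boundaries d n

theorem mem_cycles_of_comp_eq_zero {d : ∀ n, M (n + 1) →ₗ[k] M n}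
    (hd : ∀ n, d n ∘ₗ d (n + 1) = 0) (n : ℕ) (x : M (n + 1)) : d n x ∈ cycles d n := by
  cases n with
  | zero => trivial
  | succ n => exact LinearMap.congr_fun (hd n) x

variable {N : ℕ → Type*} [∀ n, AddCommGroup (N n)] [∀ n, Module k (N n)]
  {P : ℕ → Type*} [∀ n, AddCommGroup (P n)] [∀ n, Module k (P n)]
  {d : ∀ n, M (n + 1) →ₗ[k] M n} {d' : ∀ n, N (n + 1) →ₗ[k] N n} {d'' : ∀ n, P (n + 1) →ₗ[k] P n}

theorem map_mem_cycles (f : ∀ n, M n →ₗ[k] N n) (hf : ∀ n x, f n (d n x) = d' n (f (n + 1) x))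
    (n : ℕ) {x : M n} (hx : x ∈ cycles d n) : f n x ∈ cycles d' n := by
  cases n with
  | zero => trivial
  | succ n =>
    change d' n (f (n + 1) x) = 0
    rw [← hf, show d n x = 0 from hx, map_zero]

/-- The map on homology induced by a chain map. -/
def HMap (f : ∀ n, M n →ₗ[k] N n) (hf : ∀ n x, f n (d n x) = d' n (f (n + 1) x)) (n : ℕ) :
    H d n →ₗ[k] H d' n :=
  Submodule.mapQ _ _ ((f n).restrict fun _ hx => map_mem_cycles f hf n hx) (by
    rintro ⟨x, hx⟩ ⟨y, rfl⟩
    exact ⟨f (n + 1) y, (hf n y).symm⟩)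

theorem HMap_mk (f : ∀ n, M n →ₗ[k] N n) (hf : ∀ n x, f n (d n x) = d' n (f (n + 1) x)) (n : ℕ)
    (x : cycles d n) : HMap f hf n (Submodule.Quotient.mk x) =
      Submodule.Quotient.mk ⟨f n x, map_mem_cycles f hf n x.2⟩ := rfl

theorem H_mk_eq_zero_iff (n : ℕ) (x : cycles d n) :
    (Submodule.Quotient.mk x : H d n) = 0 ↔ ∃ y, d n y = x := by
  rw [Submodule.Quotient.mk_eq_zero]
  rfl

/-- An isomorphism of complexes induces an isomorphism on homology. -/
def HEquiv (f : ∀ n, M n ≃ₗ[k] N n) (hf : ∀ n x, f n (d n x) = d' n (f (n + 1) x)) (n : ℕ) :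
    H d n ≃ₗ[k] H d' n :=
  have hf' : ∀ n x, (f n).symm (d' n x) = d n ((f (n + 1)).symm x) := fun n x => by
    rw [LinearEquiv.symm_apply_eq, hf, LinearEquiv.apply_symm_apply]
  LinearEquiv.ofLinearMap (HMap (fun n => (f n : M n →ₗ[k] N n)) hf n)
    (HMap (fun n => ((f n).symm : N n →ₗ[k] M n)) hf' n)
    (by
      refine LinearMap.ext fun x => ?_
      obtain ⟨x, rfl⟩ := Submodule.Quotient.mk_surjective _ x
      simp [HMap_mk])
    (by
      refine LinearMap.ext fun x => ?_
      obtain ⟨x, rfl⟩ := Submodule.Quotient.mk_surjective _ x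
      simp [HMap_mk])

theorem finite_and_finrank_le_of_ker_le_range {A B C : Type*} [AddCommGroup A] [Module k A]
    [AddCommGroup B] [Module k B] [AddCommGroup C] [Module k C] [Module.Finite k A]
    [Module.Finite k C] (f : A →ₗ[k] B) (g : B →ₗ[k] C)
    (h : LinearMap.ker g ≤ LinearMap.range f) :
    Module.Finite k B ∧
      Module.finrank k B ≤ Module.finrank k A + Module.finrank k C := by
  have h1 : Module.Finite k (LinearMap.ker g) :=
    Submodule.finiteDimensional_of_le h
  have h2 : Module.Finite k (B ⧸ LinearMap.ker g) :=
    Module.Finite.equiv g.quotKerEquivRange.symm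
  have h3 : Module.Finite k B := Module.Finite.of_submodule_quotient (LinearMap.ker g)
  refine ⟨h3, ?_⟩
  have e1 := g.finrank_range_add_finrank_ker
  have e2 := Submodule.finrank_mono h
  have e3 := f.finrank_range_le
  have e4 := Submodule.finrank_le (LinearMap.range g)
  lia

/-- For an exact sequence of complexes, the dimension of the homology of the middle term is
at most the sum of the dimensions of the other two. -/
theorem finite_H_and_finrank_le (hd' : ∀ n, d' n ∘ₗ d' (n + 1) = 0)
    (f : ∀ n, M n →ₗ[k] N n) (hf : ∀ n x, f n (d n x) = d' n (f (n + 1) x))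
    (g : ∀ n, N n →ₗ[k] P n) (hg : ∀ n x, g n (d' n x) = d'' n (g (n + 1) x))
    (hfi : ∀ n, Function.Injective (f n)) (hgs : ∀ n, Function.Surjective (g n))
    (hfg : ∀ n x, g n x = 0 → ∃ y, f n y = x) (n : ℕ) [Module.Finite k (H d n)]
    [Module.Finite k (H d'' n)] :
    Module.Finite k (H d' n) ∧
      Module.finrank k (H d' n) ≤ Module.finrank k (H d n) + Module.finrank k (H d'' n) := by
  refine finite_and_finrank_le_of_ker_le_range (HMap f hf n) (HMap g hg n) ?_
  intro x hx
  obtain ⟨x, rfl⟩ := Submodule.Quotient.mk_surjective _ x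
  rw [LinearMap.mem_ker, HMap_mk, H_mk_eq_zero_iff] at hx
  obtain ⟨c, hc⟩ := hx
  obtain ⟨c, rfl⟩ := hgs _ c
  rw [← hg] at hc
  -- Correcting the cycle by the boundary of a lift of `c` moves it into the subcomplex, where
  -- injectivity of `f` makes it a cycle again.
  obtain ⟨y, hy⟩ := hfg n (x.1 - d' n c) (by rw [map_sub, hc, sub_self])
  have hy' : y ∈ cycles d n := by
    cases n with
    | zero => trivial
    | succ n =>
      refine hfi n ?_
      rw [hf, hy, map_sub, map_zero, show d' n x = 0 from x.2,
        show d' n (d' (n + 1) c) = 0 from LinearMap.congr_fun (hd' n) c, sub_zero]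
  refine ⟨Submodule.Quotient.mk ⟨y, hy'⟩, ?_⟩
  rw [HMap_mk, ← sub_eq_zero, ← Submodule.Quotient.mk_sub, H_mk_eq_zero_iff]
  refine ⟨-c, ?_⟩
  simp [hy]

end Homology

/-! ### Singular chains -/

/-- The standard topological `n`-simplex. -/
abbrev Simp (n : ℕ) : Type := stdSimplex ℝ (Fin (n + 1))

/-- The inclusion of the `i`-th face of the standard simplex. -/
def faceMap (n : ℕ) (i : Fin (n + 2)) : C(Simp n, Simp (n + 1)) :=
  ⟨stdSimplex.map i.succAbove, stdSimplex.continuous_map _⟩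

/-- The `i`-th face of a singular simplex. -/
def face {Y : Type*} [TopologicalSpace Y] (n : ℕ) (i : Fin (n + 2)) (σ : C(Simp (n + 1), Y)) :
    C(Simp n, Y) := σ.comp (faceMap n i)

section Finsupp

variable {k V : Type*} [Field k] [AddCommGroup V] [Module k V]

/-- The differential of the chain complex with values in `V` of a sequence of sets with face maps,
twisted by `τ`. -/
def twistedD {S T : Type*} {m : ℕ} (δ : Fin m → S → T) (τ : Fin m → S → V →ₗ[k] V) :
    (S →₀ V) →ₗ[k] (T →₀ V) :=
  altSum fun i => Finsupp.lsum k fun s => Finsupp.lsingle (δ i s) ∘ₗ τ i s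

theorem twistedD_single {S T : Type*} {m : ℕ} (δ : Fin m → S → T)
    (τ : Fin m → S → V →ₗ[k] V) (s : S) (v : V) :
    twistedD δ τ (Finsupp.single s v) =
      ∑ i : Fin m, (-1 : k) ^ (i : ℕ) • Finsupp.single (δ i s) (τ i s v) := by
  simp [twistedD, altSum_apply]

variable (k V) in
/-- The untwisted differential. -/
abbrev simplicialD {S T : Type*} {m : ℕ} (δ : Fin m → S → T) : (S →₀ V) →ₗ[k] (T →₀ V) :=
  twistedD δ fun _ _ => LinearMap.id

theorem simplicialD_single {S T : Type*} {m : ℕ} (δ : Fin m → S → T) (s : S) (v : V) :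
    simplicialD k V δ (Finsupp.single s v) =
      ∑ i : Fin m, (-1 : k) ^ (i : ℕ) • Finsupp.single (δ i s) v :=
  twistedD_single ..

theorem twistedD_comp_twistedD {S T U : Type*} {m : ℕ} (δ : Fin (m + 1) → T → U)
    (δ' : Fin (m + 2) → S → T) (τ : Fin (m + 1) → T → V →ₗ[k] V) (τ' : Fin (m + 2) → S → V →ₗ[k] V)
    (hδ : ∀ i j : Fin (m + 1), i ≤ j → ∀ s, δ i (δ' j.succ s) = δ j (δ' i.castSucc s))
    (hτ : ∀ i j : Fin (m + 1), i ≤ j → ∀ s v,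
      τ i (δ' j.succ s) (τ' j.succ s v) = τ j (δ' i.castSucc s) (τ' i.castSucc s v)) :
    twistedD δ τ ∘ₗ twistedD δ' τ' = 0 := by
  refine altSum_comp_altSum _ _ fun i j hij => ?_
  ext s v : 2
  simp [hδ i j hij, hτ i j hij]

end Finsupp

/-! ### Categorical singular homology computed by the concrete complex -/

section Bridge

variable {k : Type v} [Field k]

/-- The homology of a complex of modules in concrete terms. -/
def homologyEquiv (K : ChainComplex (ModuleCat.{u} k) ℕ) (n : ℕ) :
    K.homology n ≃ₗ[k] H (M := fun n => K.X n) (fun n => (K.d (n + 1) n).hom) n := by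
  cases n with
  | zero =>
    -- In degree 0 the next index of the complex shape is 0 itself, and `K.d 0 0 = 0`; this matches
    -- the convention that all 0-chains are cycles.
    let e₁ : K.homology 0 ≃ₗ[k] (LinearMap.ker (K.sc' 1 0 0).g.hom ⧸
        LinearMap.range (K.sc' 1 0 0).moduleCatToCycles) :=
      (((ShortComplex.homologyMapIso (K.isoSc' 1 0 0 (by simp) (by simp))) ≪≫
        (K.sc' 1 0 0).moduleCatHomologyIso).toLinearEquiv)
    let e₂ : LinearMap.ker (K.sc' 1 0 0).g.hom ≃ₗ[k]
        cycles (M := fun n => K.X n) (fun n => (K.d (n + 1) n).hom) 0 :=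
      LinearEquiv.ofEq _ _ (by
        change LinearMap.ker (K.d 0 0).hom = (⊤ : Submodule k (K.X 0))
        rw [K.shape 0 0 (by simp)]
        exact LinearMap.ker_zero)
    refine e₁.trans (Submodule.Quotient.equiv _ _ e₂ ?_)
    ext ⟨x, hx⟩
    constructor
    · rintro ⟨_, ⟨y, rfl⟩, h⟩
      exact ⟨y, congrArg Subtype.val h⟩
    · rintro ⟨y, h⟩
      exact ⟨_, ⟨y, rfl⟩, Subtype.ext h⟩
  | succ n =>
    let e₁ : K.homology (n + 1) ≃ₗ[k] (LinearMap.ker (K.sc' (n + 2) (n + 1) n).g.hom ⧸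
        LinearMap.range (K.sc' (n + 2) (n + 1) n).moduleCatToCycles) :=
      (((ShortComplex.homologyMapIso (K.isoSc' (n + 2) (n + 1) n (by simp) (by simp))) ≪≫
        (K.sc' (n + 2) (n + 1) n).moduleCatHomologyIso).toLinearEquiv)
    let e₂ : LinearMap.ker (K.sc' (n + 2) (n + 1) n).g.hom ≃ₗ[k]
        cycles (M := fun n => K.X n) (fun n => (K.d (n + 1) n).hom) (n + 1) :=
      LinearEquiv.refl _ _
    refine e₁.trans (Submodule.Quotient.equiv _ _ e₂ ?_)
    ext ⟨x, hx⟩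
    constructor
    · rintro ⟨_, ⟨y, rfl⟩, h⟩
      exact ⟨y, congrArg Subtype.val h⟩
    · rintro ⟨y, h⟩
      exact ⟨_, ⟨y, rfl⟩, Subtype.ext h⟩

/-- The module of simplicial chains is a module of finitely supported functions. -/
def chainEquiv (Z : SSet.{w}) (n : ℕ) {S : Type w} (e : Z.obj (.op (.mk n)) ≃ S) :
    ((Z.chainComplex (ModuleCat.of k (ULift.{w} k))).X n : ModuleCat.{max v w} k) ≃ₗ[k]
      (S →₀ ULift.{w} k) :=
  let c := Z.isColimitChainComplexXCofan (ModuleCat.of k (ULift.{w} k)) n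
  let f : ((Z.chainComplex (ModuleCat.of k (ULift.{w} k))).X n : ModuleCat.{max v w} k) ⟶
      ModuleCat.of k (S →₀ ULift.{w} k) :=
    c.desc (Limits.Cofan.mk _ fun x => ModuleCat.ofHom (Finsupp.lsingle (e x)))
  have hf : ∀ x, Z.ιChainComplex x ≫ f = ModuleCat.ofHom (Finsupp.lsingle (e x)) := fun x =>
    c.fac _ (.mk x)
  LinearEquiv.ofLinearMap f.hom
    (Finsupp.lsum k fun s => (Z.ιChainComplex (R := ModuleCat.of k (ULift.{w} k)) (e.symm s)).hom)
    (by
      ext s a : 2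
      have := congrArg (fun g => g.hom a) (hf (e.symm s))
      simpa using this)
    (by
      have : f ≫ ModuleCat.ofHom (Finsupp.lsum k fun s =>
          (Z.ιChainComplex (R := ModuleCat.of k (ULift.{w} k)) (e.symm s)).hom) = 𝟙 _ := by
        refine SSet.chainComplex_hom_ext fun x => ?_
        rw [← Category.assoc, hf]
        ext a
        simp
      exact congrArg ModuleCat.Hom.hom this)

theorem chainEquiv_ι (Z : SSet.{w}) (n : ℕ) {S : Type w} (e : Z.obj (.op (.mk n)) ≃ S)
    (x : Z.obj (.op (.mk n))) (a : ULift.{w} k) :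
    chainEquiv Z n e ((Z.ιChainComplex (R := ModuleCat.of k (ULift.{w} k)) x).hom a) =
      Finsupp.single (e x) a := by
  have := (Z.isColimitChainComplexXCofan (ModuleCat.of k (ULift.{w} k)) n).fac
    (Limits.Cofan.mk (ModuleCat.of k (S →₀ ULift.{w} k))
      fun x => ModuleCat.ofHom (Finsupp.lsingle (e x))) (.mk x)
  exact congrArg (fun g => g.hom a) this

theorem chainEquiv_d (Z : SSet.{w}) {S : ℕ → Type w} (e : ∀ n, Z.obj (.op (.mk n)) ≃ S n)
    (δ : ∀ n, Fin (n + 2) → S (n + 1) → S n)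
    (hδ : ∀ n i x, e n (Z.δ i x) = δ n i (e (n + 1) x)) (n : ℕ)
    (x : (Z.chainComplex (ModuleCat.of k (ULift.{w} k))).X (n + 1)) :
    chainEquiv Z n (e n) (((Z.chainComplex (ModuleCat.of k (ULift.{w} k))).d (n + 1) n).hom x) =
      simplicialD k (ULift.{w} k) (δ n) (chainEquiv Z (n + 1) (e (n + 1)) x) := by
  let E (n : ℕ) : (Z.chainComplex (ModuleCat.of k (ULift.{w} k))).X n ⟶
    ModuleCat.of k (S n →₀ ULift.{w} k) := ModuleCat.ofHom (chainEquiv Z n (e n)).toLinearMap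
  have hE (n : ℕ) (x) : Z.ιChainComplex x ≫ E n = ModuleCat.ofHom (Finsupp.lsingle (e n x)) := by
    ext1
    ext1 a
    exact chainEquiv_ι Z n (e n) x a
  have : (Z.chainComplex (ModuleCat.of k (ULift.{w} k))).d (n + 1) n ≫ E n =
      E (n + 1) ≫ ModuleCat.ofHom (simplicialD k (ULift.{w} k) (δ n)) := by
    refine SSet.chainComplex_hom_ext fun x => ?_
    rw [SSet.ιChainComplex_d_assoc, ← Category.assoc, hE, Preadditive.sum_comp]
    simp only [Preadditive.zsmul_comp, hE]
    ext1
    ext1 a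
    simp only [ModuleCat.hom_sum, ModuleCat.hom_zsmul, ModuleCat.hom_comp, ModuleCat.hom_ofHom,
      LinearMap.comp_apply, simplicialD_single, LinearMap.sum_apply, LinearMap.smul_apply,
      Finsupp.lsingle_apply, hδ]
    refine Finset.sum_congr rfl fun i _ => ?_
    rcases Nat.even_or_odd (i : ℕ) with h | h <;> simp [h.neg_one_pow]
  exact congrArg (fun g => g.hom x) this

variable {Y : Type w} [TopologicalSpace Y]

variable (k Y) in
/-- The differential of the singular chain complex. -/
def singularD (n : ℕ) : (C(Simp (n + 1), Y) →₀ k) →ₗ[k] (C(Simp n, Y) →₀ k) :=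
  simplicialD k k (face n)

variable (k Y) in
/-- The singular homology, in concrete terms. -/
abbrev SingularH (n : ℕ) : Type (max v w) := H (M := fun n => C(Simp n, Y) →₀ k) (singularD k Y) n

theorem toSSetObjEquiv_δ (n : ℕ) (i : Fin (n + 2))
    (x : (TopCat.toSSet.obj (TopCat.of Y)).obj (.op (.mk (n + 1)))) :
    TopCat.toSSetObjEquiv _ (.op (.mk n)) ((TopCat.toSSet.obj (TopCat.of Y)).δ i x) =
      face n i (TopCat.toSSetObjEquiv _ (.op (.mk (n + 1))) x) := by
  rfl

theorem mapRange_simplicialD {V W : Type*} [AddCommGroup V] [Module k V] [AddCommGroup W]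
    [Module k W] (f : V →ₗ[k] W) {S T : Type*} {m : ℕ} (δ : Fin m → S → T) (x : S →₀ V) :
    Finsupp.mapRange.linearMap f (simplicialD k V δ x) =
      simplicialD k W δ (Finsupp.mapRange.linearMap f x) := by
  induction x using Finsupp.induction_linear with
  | zero => simp
  | add x y hx hy => simp only [map_add, hx, hy]
  | single s v => simp [simplicialD_single]

/-- Singular homology in concrete terms. -/
def singularEquiv (n : ℕ) : homology k n Y ≃ₗ[k] SingularH k Y n :=
  let K : ChainComplex (ModuleCat.{max v w} k) ℕ :=
    (TopCat.toSSet.obj (TopCat.of Y)).chainComplex (ModuleCat.of k (ULift.{w} k))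
  let e₁ : K.homology n ≃ₗ[k] H (M := fun n => K.X n) (fun n => (K.d (n + 1) n).hom) n :=
    homologyEquiv K n
  let e (n : ℕ) : K.X n ≃ₗ[k] (C(Simp n, Y) →₀ ULift.{w} k) :=
    chainEquiv (TopCat.toSSet.obj (TopCat.of Y)) n
      (TopCat.toSSetObjEquiv (TopCat.of Y) (.op (.mk n)))
  let e' (n : ℕ) : K.X n ≃ₗ[k] (C(Simp n, Y) →₀ k) :=
    (e n).trans (Finsupp.mapRange.linearEquiv ULift.moduleEquiv)
  have he (n : ℕ) (x : K.X (n + 1)) : e n ((K.d (n + 1) n).hom x) =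
      simplicialD k (ULift.{w} k) (face n) (e (n + 1) x) :=
    chainEquiv_d _ _ _ toSSetObjEquiv_δ n x
  have he' (n : ℕ) (x : K.X (n + 1)) : e' n ((K.d (n + 1) n).hom x) =
      singularD k Y n (e' (n + 1) x) :=
    (congrArg (Finsupp.mapRange.linearEquiv ULift.moduleEquiv) (he n x)).trans
      (mapRange_simplicialD (ULift.moduleEquiv (R := k) (M := k)).toLinearMap (face n) _)
  e₁.trans (HEquiv e' he' n)

end Bridge

/-! ### Twisted coefficients in a representation of a `p`-group -/

section Twisted

variable {k : Type*} [Field k] {G : Type*} [Group G]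

/-- A nonzero representation of a finite `p`-group in characteristic `p` has a nonzero
fixed vector. -/
theorem exists_fixed_vector {p : ℕ} [Fact p.Prime] [CharP k p] [Finite G] (hG : IsPGroup p G)
    {V : Type*} [AddCommGroup V] [Module k V] [Nontrivial V] (ρ : Representation k G V) :
    ∃ v : V, v ≠ 0 ∧ ∀ g, ρ g v = v := by
  obtain ⟨v, hv⟩ := exists_ne (0 : V)
  let _ : Algebra (ZMod p) k := ZMod.algebra k p
  let _ : Module (ZMod p) V := Module.compHom V (algebraMap (ZMod p) k)
  have : IsScalarTower (ZMod p) k V := IsScalarTower.of_algebraMap_smul fun _ _ => rfl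
  -- `V` may be infinite, so points are counted in the 𝔽_p-span of one orbit: it is finite, stable,
  -- and of order divisible by `p`, so the fixed vector 0 cannot be the only one.
  let A : Submodule (ZMod p) V := Submodule.span (ZMod p) (Set.range fun g => ρ g v)
  have hA : ∀ g, ∀ a ∈ A, ρ g a ∈ A := by
    intro g a ha
    induction ha using Submodule.span_induction with
    | mem x hx =>
      obtain ⟨h, rfl⟩ := hx
      refine Submodule.subset_span ⟨g * h, ?_⟩
      simp
    | zero => simp
    | add x y _ _ hx hy => rw [map_add]; exact A.add_mem hx hy
    | smul c x _ hx =>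
      have : ρ g (c • x) = c • ρ g x := (ρ g).map_smul_of_tower c x
      rw [this]
      exact A.smul_mem c hx
  let _ : MulAction G A :=
    { smul := fun g a => ⟨ρ g a, hA g a a.2⟩
      one_smul := fun a => Subtype.ext (by change ρ 1 _ = _; simp)
      mul_smul := fun g h a => Subtype.ext (by change ρ (g * h) _ = ρ g (ρ h _); simp) }
  have hsm (g : G) (a : A) : ((g • a : A) : V) = ρ g a := rfl
  have hfin : Module.Finite (ZMod p) A := Module.Finite.span_of_finite _ (Set.finite_range _)
  have hfin' : Finite A := Module.finite_of_finite (ZMod p)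
  have hvA : v ∈ A := Submodule.subset_span ⟨1, by simp⟩
  have : Nontrivial A := ⟨⟨v, hvA⟩, 0, fun h => hv (congrArg Subtype.val h)⟩
  have hcard : p ∣ Nat.card A := by
    rw [Module.natCard_eq_pow_finrank (K := ZMod p), Nat.card_zmod]
    exact dvd_pow_self p Module.finrank_pos.ne'
  obtain ⟨b, hb, hb0⟩ := hG.exists_fixed_point_of_prime_dvd_card_of_fixed_point A hcard
    (a := 0) (fun g => Subtype.ext (by rw [hsm]; simp))
  exact ⟨b, fun h => hb0 (Subtype.ext h.symm), fun g => congrArg Subtype.val (hb g)⟩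

/-- A sequence of sets with face maps satisfying the simplicial identities. -/
def IsPresimplicial {S : ℕ → Type*} (δ : ∀ n, Fin (n + 2) → S (n + 1) → S n) : Prop :=
  ∀ n (i j : Fin (n + 2)), i ≤ j → ∀ s, δ n i (δ (n + 1) j.succ s) = δ n j (δ (n + 1) i.castSucc s)

/-- The face maps of the covering of a presimplicial set given by `g`. -/
def twistedFace {S : ℕ → Type*} (δ : ∀ n, Fin (n + 2) → S (n + 1) → S n)
    (g : ∀ n, S (n + 1) → G) (n : ℕ) (i : Fin (n + 2)) (s : S (n + 1) × G) : S n × G :=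
  (δ n i s.1, if i = 0 then g n s.1 * s.2 else s.2)

/-- The differential with coefficients in a representation. -/
def repD {S : ℕ → Type*} (δ : ∀ n, Fin (n + 2) → S (n + 1) → S n) (g : ∀ n, S (n + 1) → G)
    {V : Type*} [AddCommGroup V] [Module k V] (ρ : Representation k G V) (n : ℕ) :
    (S (n + 1) →₀ V) →ₗ[k] (S n →₀ V) :=
  twistedD (δ n) fun i s => if i = 0 then ρ (g n s) else LinearMap.id

variable {S : ℕ → Type*} {δ : ∀ n, Fin (n + 2) → S (n + 1) → S n} {g : ∀ n, S (n + 1) → G}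

theorem repD_single {V : Type*} [AddCommGroup V] [Module k V] (ρ : Representation k G V) (n : ℕ)
    (s : S (n + 1)) (v : V) : repD δ g ρ n (Finsupp.single s v) =
      ∑ i : Fin (n + 2), (-1 : k) ^ (i : ℕ) •
        Finsupp.single (δ n i s) (if i = 0 then ρ (g n s) v else v) := by
  rw [repD, twistedD_single]
  refine Finset.sum_congr rfl fun i _ => ?_
  split_ifs <;> rfl

/-- The second coordinates of the simplicial identities of `twistedFace`, evaluated at 1, are
cocycle identities for `g`; applying `ρ` to them gives the compatibility of the twists. -/
theorem repD_comp_repD (h : IsPresimplicial (S := fun n => S n × G) (twistedFace δ g))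
    {V : Type*} [AddCommGroup V] [Module k V] (ρ : Representation k G V) (n : ℕ) :
    repD δ g ρ n ∘ₗ repD δ g ρ (n + 1) = 0 := by
  refine twistedD_comp_twistedD _ _ _ _
    (fun i j hij s => congrArg Prod.fst (h n i j hij (s, 1))) fun i j hij s v => ?_
  have key := congrArg Prod.snd (h n i j hij (s, 1))
  simp only [twistedFace, Fin.succ_ne_zero, if_false, mul_one] at key
  have e0 : (Fin.castSucc i = 0) ↔ i = 0 := by simp
  simp only [Fin.succ_ne_zero, if_false, e0, LinearMap.id_apply] at key ⊢
  by_cases hi : i = 0 <;> by_cases hj : j = 0 <;> simp_all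

theorem map_repD {V W : Type*} [AddCommGroup V] [Module k V] [AddCommGroup W] [Module k W]
    {ρ : Representation k G V} {ρ' : Representation k G W} (f : V →ₗ[k] W)
    (hf : ∀ x v, f (ρ x v) = ρ' x (f v)) (n : ℕ) (x : S (n + 1) →₀ V) :
    Finsupp.mapRange.linearMap f (repD δ g ρ n x) =
      repD δ g ρ' n (Finsupp.mapRange.linearMap f x) := by
  induction x using Finsupp.induction_linear with
  | zero => simp
  | add x y hx hy => simp only [map_add, hx, hy]
  | single s v =>
    rw [repD_single, Finsupp.mapRange.linearMap_apply, Finsupp.mapRange.linearMap_apply,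
      Finsupp.mapRange_single, repD_single, ← Finsupp.mapRange.linearMap_apply, map_sum]
    refine Finset.sum_congr rfl fun i _ => ?_
    split_ifs <;> simp [hf]

theorem repD_trivial {V : Type*} [AddCommGroup V] [Module k V] :
    repD δ g (1 : Representation k G V) = fun n => simplicialD k V (δ n) := by
  funext n
  ext s v : 2
  simp only [LinearMap.comp_apply, Finsupp.lsingle_apply, repD_single, simplicialD_single]
  simp

/-- Induction on the dimension of the coefficients. A fixed vector spans a trivial line `W`, and the
exact sequence of complexes with coefficients in `k`, `V` and `V ⧸ W` adds at most one copy of the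
untwisted homology. -/
theorem finite_H_repD {p : ℕ} [Fact p.Prime] [CharP k p] [Finite G] (hG : IsPGroup p G)
    (h : IsPresimplicial (S := fun n => S n × G) (twistedFace δ g)) (n : ℕ)
    [Module.Finite k (H (M := fun n => S n →₀ k) (fun n => simplicialD k k (δ n)) n)]
    (m : ℕ) : ∀ {V : Type*} [AddCommGroup V] [Module k V] [Module.Finite k V]
    (ρ : Representation k G V), Module.finrank k V = m →
    Module.Finite k (H (M := fun n => S n →₀ V) (repD δ g ρ) n) ∧
      Module.finrank k (H (M := fun n => S n →₀ V) (repD δ g ρ) n) ≤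
        m * Module.finrank k (H (M := fun n => S n →₀ k) (fun n => simplicialD k k (δ n)) n) := by
  induction m with
  | zero =>
    intro V _ _ _ ρ hV
    have := Module.finrank_zero_iff.1 hV
    have hs : Subsingleton (H (M := fun n => S n →₀ V) (repD δ g ρ) n) := by
      have : Subsingleton (cycles (M := fun n => S n →₀ V) (repD δ g ρ) n) := inferInstance
      exact (Submodule.Quotient.mk_surjective _).subsingleton
    exact ⟨inferInstance, by rw [Module.finrank_zero_of_subsingleton]; simp⟩
  | succ m ih =>
    intro V _ _ _ ρ hV
    have : Nontrivial V := Module.nontrivial_of_finrank_pos (R := k) (by lia)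
    obtain ⟨v, hv, hρ⟩ := exists_fixed_vector hG ρ
    let W : Submodule k V := k ∙ v
    have hW : ∀ x, W ≤ W.comap (ρ x) := by
      intro x
      rw [Submodule.span_singleton_le_iff_mem, Submodule.mem_comap, hρ]
      exact Submodule.mem_span_singleton_self v
    have hdim : Module.finrank k (V ⧸ W) = m := by
      have := W.finrank_quotient_add_finrank
      rw [finrank_span_singleton hv] at this
      lia
    obtain ⟨i1, i2⟩ := ih (ρ.quotient W hW) hdim
    let f : k →ₗ[k] V := LinearMap.toSpanSingleton k V v
    have hf (x : G) (c : k) : f ((1 : Representation k G k) x c) = ρ x (f c) := by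
      simp [f, hρ]
    have hq (x : G) (u : V) : W.mkQ (ρ x u) = ρ.quotient W hW x (W.mkQ u) := rfl
    have hfin : Module.Finite k (H (M := fun n => S n →₀ k)
        (repD δ g (1 : Representation k G k)) n) := by
      rwa [repD_trivial]
    have key := finite_H_and_finrank_le (M := fun n => S n →₀ k) (N := fun n => S n →₀ V)
      (P := fun n => S n →₀ (V ⧸ W))
      (repD_comp_repD h ρ) (fun _ => Finsupp.mapRange.linearMap f)
      (fun n x => map_repD f hf n x) (fun _ => Finsupp.mapRange.linearMap W.mkQ)
      (fun n x => map_repD W.mkQ hq n x)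
      (fun n => Finsupp.mapRange_injective f (map_zero f)
        (smul_left_injective k hv))
      (fun n => Finsupp.mapRange_surjective W.mkQ (map_zero _) W.mkQ_surjective) ?_ n
    · refine ⟨key.1, (key.2.trans (add_le_add_right i2 _)).trans_eq ?_⟩
      rw [add_mul, one_mul, add_comm]
      congr 1
      change Module.finrank k (H (M := fun n => S n →₀ k)
        (repD δ g (1 : Representation k G k)) n) = _
      rw [repD_trivial]
    · intro n x hx
      have hx' (s : S n) : ∃ c : k, f c = x s := by
        have h0 : W.mkQ (x s) = 0 := by
          simpa using DFunLike.congr_fun hx s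
        rw [Submodule.mkQ_apply, Submodule.Quotient.mk_eq_zero] at h0
        exact Submodule.mem_span_singleton.1 h0
      choose c hc using hx'
      refine ⟨Finsupp.onFinset x.support c fun s hs => ?_, ?_⟩
      · rw [Finsupp.mem_support_iff, ← hc]
        simpa [f, hv] using hs
      · ext s
        simp [hc]

/-- The homology of a covering of a presimplicial set by a free action of a finite `p`-group,
in characteristic `p`. -/
theorem finite_H_covering {p : ℕ} [Fact p.Prime] [CharP k p] [Finite G] (hG : IsPGroup p G)
    {T : ℕ → Type*} {δT : ∀ n, Fin (n + 2) → T (n + 1) → T n} (hT : IsPresimplicial δT)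
    (e : ∀ n, T n ≃ S n × G)
    (he : ∀ n i t, e n (δT n i t) = twistedFace δ g n i (e (n + 1) t)) (n : ℕ)
    [Module.Finite k (H (M := fun n => S n →₀ k) (fun n => simplicialD k k (δ n)) n)] :
    Module.Finite k (H (M := fun n => T n →₀ k) (fun n => simplicialD k k (δT n)) n) ∧
      Module.finrank k (H (M := fun n => T n →₀ k) (fun n => simplicialD k k (δT n)) n) ≤
        Nat.card G *
          Module.finrank k (H (M := fun n => S n →₀ k) (fun n => simplicialD k k (δ n)) n) := by
  have hS : IsPresimplicial (S := fun n => S n × G) (twistedFace δ g) := by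
    intro n i j hij s
    obtain ⟨t, rfl⟩ := (e _).surjective s
    rw [← he, ← he, hT n i j hij, he, he]
  -- The regular representation: currying turns chains on S × G into chains on S with values in
  -- k[G], and the twist of the zeroth face becomes left translation.
  let ρ : Representation k G (G →₀ k) :=
    { toFun := fun x => Finsupp.lmapDomain k k (x * ·)
      map_one' := by ext; simp
      map_mul' := fun x y => by ext; simp [mul_assoc] }
  have key := finite_H_repD hG hS n (Nat.card G) ρ (by
    have := Fintype.ofFinite G
    rw [Module.finrank_finsupp_self, Nat.card_eq_fintype_card])
  let f (n : ℕ) : (T n →₀ k) ≃ₗ[k] (S n →₀ G →₀ k) :=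
    (Finsupp.domLCongr (e n)).trans (Finsupp.curryLinearEquiv k)
  have hf1 (n : ℕ) (t : T n) (c : k) : f n (Finsupp.single t c) =
      Finsupp.single (e n t).1 (Finsupp.single (e n t).2 c) := by
    simp [f, Finsupp.curryLinearEquiv]
  have hf (n : ℕ) (x : T (n + 1) →₀ k) :
      f n (simplicialD k k (δT n) x) = repD δ g ρ n (f (n + 1) x) := by
    induction x using Finsupp.induction_linear with
    | zero => simp
    | add x y hx hy => simp only [map_add, hx, hy]
    | single t c =>
      rw [simplicialD_single, hf1, repD_single, map_sum]
      refine Finset.sum_congr rfl fun i _ => ?_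
      rw [map_smul, hf1, he]
      congr 1
      simp only [twistedFace]
      split_ifs <;> simp [ρ]
  have E := HEquiv (M := fun n => T n →₀ k) (N := fun n => S n →₀ G →₀ k) f hf n
  have := key.1
  exact ⟨Module.Finite.equiv E.symm, E.finrank_eq.trans_le key.2⟩

end Twisted

/-! ### Singular simplices of coverings -/

section Simp

theorem faceMap_comp_faceMap (n : ℕ) {i j : Fin (n + 2)} (hij : i ≤ j) :
    (faceMap (n + 1) j.succ).comp (faceMap n i) =
      (faceMap (n + 1) i.castSucc).comp (faceMap n j) := by
  ext1 s
  change stdSimplex.map _ (stdSimplex.map _ s) = stdSimplex.map _ (stdSimplex.map _ s)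
  rw [stdSimplex.map_comp_apply, stdSimplex.map_comp_apply]
  congr 1
  funext a
  simp only [Function.comp_apply, Fin.succAbove, Fin.lt_def, Fin.le_def] at hij ⊢
  grind

theorem isPresimplicial_face (Y : Type*) [TopologicalSpace Y] :
    IsPresimplicial (S := fun n => C(Simp n, Y)) face := fun n _ _ hij σ =>
  congrArg σ.comp (faceMap_comp_faceMap n hij)

theorem singularD_comp_singularD {k Y : Type*} [Field k] [TopologicalSpace Y] (n : ℕ) :
    singularD k Y n ∘ₗ singularD k Y (n + 1) = 0 :=
  twistedD_comp_twistedD _ _ _ _ (isPresimplicial_face Y n) fun _ _ _ _ _ => rfl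

/-- The initial vertex of the standard simplex. -/
abbrev vertexZero (n : ℕ) : Simp n := stdSimplex.vertex 0

/-- This is why only the zeroth face is twisted: the others keep the initial vertex. -/
theorem faceMap_vertexZero {n : ℕ} {i : Fin (n + 2)} (hi : i ≠ 0) :
    faceMap n i (vertexZero n) = vertexZero (n + 1) := by
  change stdSimplex.map _ _ = _
  rw [stdSimplex.map_vertex, Fin.succAbove_ne_zero_zero hi]

/-- The straight segment between two points of a simplex. -/
def segment {n : ℕ} (a b : Simp n) (t : unitInterval) : Simp n :=
  ⟨(1 - (t : ℝ)) • a.1 + (t : ℝ) • b.1, convex_stdSimplex ℝ _ a.2 b.2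
    (sub_nonneg.2 t.2.2) t.2.1 (by ring)⟩

theorem continuous_segment {n : ℕ} :
    Continuous fun x : Simp n × Simp n × unitInterval => segment x.1 x.2.1 x.2.2 := by
  unfold segment
  fun_prop

theorem segment_zero {n : ℕ} (a b : Simp n) : segment a b 0 = a := Subtype.ext (by simp [segment])

theorem segment_one {n : ℕ} (a b : Simp n) : segment a b 1 = b := Subtype.ext (by simp [segment])

theorem segment_self {n : ℕ} (a : Simp n) (t : unitInterval) : segment a a t = a :=
  Subtype.ext (by simp [segment, ← add_smul])

/-- The straight path between two points of a simplex. -/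
def segmentPath {n : ℕ} (a b : Simp n) : Path a b where
  toFun := segment a b
  continuous_toFun := continuous_segment.comp (by fun_prop : Continuous fun t => (a, b, t))
  source' := segment_zero a b
  target' := segment_one a b

end Simp

/-! ### Lifting simplices to a cover and labelling them by cosets -/

section Lift

variable {E : Type*} {X : Type*} [TopologicalSpace E] [TopologicalSpace X] {q : C(E, X)}

/-- The straight contraction to the initial vertex presents `σ` as the end of a homotopy from a
constant map, and homotopies lift. The track of the initial vertex lifts a constant path, so it
stays at `e`. -/
theorem exists_lift (hq : IsCoveringMap q) {n : ℕ} (σ : C(Simp n, X)) (e : E)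
    (he : q e = σ (vertexZero n)) : ∃ τ : C(Simp n, E), q.comp τ = σ ∧ τ (vertexZero n) = e := by
  let F : C(unitInterval × Simp n, X) :=
    ⟨fun x => σ (segment (vertexZero n) x.2 x.1), σ.continuous.comp (continuous_segment.comp
      (by fun_prop : Continuous fun x : unitInterval × Simp n => (vertexZero n, x.2, x.1)))⟩
  have F0 : ∀ a, F (0, a) = q (ContinuousMap.const (Simp n) e a) := fun a => by
    simp [F, segment_zero, he]
  let L := hq.liftHomotopy F (.const _ e) F0
  have hL : ∀ x, q (L x) = F x := fun x => congrFun (hq.liftHomotopy_lifts F _ F0) x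
  refine ⟨L.comp ⟨fun s => (1, s), by fun_prop⟩, ?_, ?_⟩
  · ext s
    change q (L (1, s)) = σ s
    rw [hL]
    simp [F, segment_one]
  · have hc := hq.eq_of_comp_eq (g₁ := fun t => L (t, vertexZero n)) (g₂ := fun _ => e)
      (by fun_prop) (by fun_prop) (by
        funext t
        change q (L (t, vertexZero n)) = q e
        rw [hL]
        simp [F, segment_self, he]) 0 (hq.liftHomotopy_zero F _ F0 _)
    exact congrFun hc 1

theorem lift_unique (hq : IsCoveringMap q) {n : ℕ} {τ τ' : C(Simp n, E)}
    (h : q.comp τ = q.comp τ') (h0 : τ (vertexZero n) = τ' (vertexZero n)) : τ = τ' :=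
  DFunLike.coe_injective (hq.eq_of_comp_eq τ.continuous τ'.continuous
    (congrArg DFunLike.coe h) _ h0)

-- The stabilizer of `e₀` under monodromy: a loop fixes `e₀` exactly when its lift from `e₀` closes
-- up.
open Path.Homotopic in
theorem monodromy_eq_self_iff (hq : IsCoveringMap q) {x₀ : X} {e₀ : E} (he : q e₀ = x₀)
    (c : FundamentalGroup X x₀) :
    hq.monodromy c ⟨e₀, he⟩ = ⟨e₀, he⟩ ↔ c ∈ (FundamentalGroup.mapOfEq q he).range := by
  constructor
  · intro h
    have key := hq.map_liftPathQuotient c ⟨e₀, he⟩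
    -- The endpoint of the lifted class depends on the monodromy, so the class is generalized before
    -- `h` can be used to close it up.
    revert key
    generalize hq.liftPathQuotient c ⟨e₀, he⟩ = P
    revert P
    rw [h]
    intro P hP
    refine ⟨P, ?_⟩
    rw [FundamentalGroup.mapOfEq_apply]
    subst he
    rw [Path.Homotopic.Quotient.cast_rfl_rfl] at hP ⊢
    exact hP
  · rintro ⟨P, rfl⟩
    refine hq.monodromy_eq_of_map_eq P ?_
    rw [FundamentalGroup.mapOfEq_apply]
    subst he
    simp only [Path.Homotopic.Quotient.cast_rfl_rfl]
    rfl

/-- The loop associated to an edge, given paths from the base point to all points. -/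
def edgeLoop {x₀ : X} (γ : ∀ x, Path.Homotopic.Quotient x₀ x) {x y : X}
    (c : Path.Homotopic.Quotient x y) : FundamentalGroup X x₀ :=
  ((γ x).trans c).trans (γ y).symm

/-- The loop associated to the initial edge of a singular simplex. -/
def simplexLoop {x₀ : X} (γ : ∀ x, Path.Homotopic.Quotient x₀ x) (n : ℕ) (σ : C(Simp (n + 1), X)) :
    FundamentalGroup X x₀ :=
  edgeLoop γ (.mk ((segmentPath (vertexZero (n + 1)) (faceMap n 0 (vertexZero n))).map
    σ.continuous))

theorem monodromy_symm (hq : IsCoveringMap q) {x y : X} (c : Path.Homotopic.Quotient x y) (e) :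
    hq.monodromy c (hq.monodromy c.symm e) = e := by
  obtain ⟨c, rfl⟩ := Path.Homotopic.Quotient.mk_surjective c
  rw [← hq.monodromy_trans_apply]
  have : (Path.Homotopic.Quotient.mk c).symm.trans (.mk c) = .refl _ :=
    Path.Homotopic.Quotient.eq.2 ⟨(Path.Homotopy.reflSymmTrans c).symm⟩
  exact (congrArg (fun c => hq.monodromy c e) this).trans (congrFun hq.monodromy_refl e)

/-- The simplices of a covering space correspond to pairs of a simplex of the base and a point of
the fibre over the base point. -/
theorem exists_simplices_equiv {x₀ : X} (γ : ∀ x, Path.Homotopic.Quotient x₀ x)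
    {K : Subgroup (FundamentalGroup X x₀)} (h : IsCoverAssociatedTo q K) :
    ∃ e : ∀ n, C(Simp n, E) ≃ C(Simp n, X) × (FundamentalGroup X x₀ ⧸ K),
      ∀ n i τ, e n (face n i τ) = (face n i (e (n + 1) τ).1,
        if i = 0 then simplexLoop γ n (e (n + 1) τ).1 • (e (n + 1) τ).2 else (e (n + 1) τ).2) := by
  obtain ⟨hq, hE, e₀, he₀, hK⟩ := h
  let b : q ⁻¹' {x₀} := ⟨e₀, he₀⟩
  let _ := hq.fundamentalGroupMulAction x₀
  have hsm (c : FundamentalGroup X x₀) (f : q ⁻¹' {x₀}) : c • f = hq.monodromy c f := rfl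
  have hmem (c : FundamentalGroup X x₀) : c • b = b ↔ c ∈ K := by
    rw [← hK]; exact monodromy_eq_self_iff hq he₀ c
  have hmem' (c c' : FundamentalGroup X x₀) :
      c • b = c' • b ↔ (c : FundamentalGroup X x₀ ⧸ K) = c' := by
    rw [QuotientGroup.eq, ← hmem, mul_smul, inv_smul_eq_iff, eq_comm]
  -- Orbit and stabilizer identify the cosets of `K` with the fibre over `x₀`; transport along `γ x`
  -- carries this to the fibre over `x`. Surjectivity comes from the path-connectedness of `E`.
  let Ψ (x : X) : FundamentalGroup X x₀ ⧸ K → q ⁻¹' {x} :=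
    Quotient.lift (fun c => hq.monodromy (γ x) (c • b)) fun c c' hc => by
      rw [(hmem' c c').2 (Quotient.sound hc)]
  have hΨmk (x : X) (c : FundamentalGroup X x₀) : Ψ x c = hq.monodromy (γ x) (c • b) := rfl
  have hΨ (x : X) : Function.Bijective (Ψ x) := by
    constructor
    · intro c c'
      obtain ⟨c, rfl⟩ := QuotientGroup.mk_surjective c
      obtain ⟨c', rfl⟩ := QuotientGroup.mk_surjective c'
      intro hc
      rw [← hmem']
      exact (hq.monodromy_bijective (γ x)).1 hc
    · intro f
      have hf : q f.1 = x := f.2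
      let P : Path.Homotopic.Quotient e₀ f.1 := .mk (PathConnectedSpace.somePath e₀ f.1)
      let c : FundamentalGroup X x₀ := ((P.map q).cast he₀.symm hf.symm).trans (γ x).symm
      refine ⟨(c : FundamentalGroup X x₀ ⧸ K), ?_⟩
      rw [hΨmk, hsm, hq.monodromy_trans_apply, monodromy_symm]
      exact hq.monodromy_eq_of_map_eq P ((Path.Homotopic.Quotient.cast_rfl_rfl (P.map q)).symm.trans
        (Path.Homotopic.Quotient.cast_cast (P.map q) he₀.symm hf.symm he₀ hf).symm)
  let coord (e : E) : FundamentalGroup X x₀ ⧸ K := (Equiv.ofBijective _ (hΨ (q e))).symm ⟨e, rfl⟩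
  have hcoord (e : E) : Ψ (q e) (coord e) = ⟨e, rfl⟩ :=
    (Equiv.ofBijective _ (hΨ (q e))).apply_symm_apply _
  -- Moving along a path upstairs multiplies the coset label by the loop that its projection closes
  -- up to.
  have hpath {e e' : E} (P : Path.Homotopic.Quotient e e') :
      coord e' = edgeLoop γ (P.map q) • coord e := by
    apply (hΨ (q e')).1
    rw [hcoord]
    obtain ⟨c, hc⟩ := QuotientGroup.mk_surjective (coord e)
    have h1 := hcoord e
    rw [← hc, hΨmk] at h1
    rw [← hc]
    change _ = Ψ (q e') ((edgeLoop γ (P.map q) * c : FundamentalGroup X x₀) :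
      FundamentalGroup X x₀ ⧸ K)
    rw [hΨmk, mul_smul, hsm, edgeLoop, hq.monodromy_trans_apply, monodromy_symm,
      hq.monodromy_trans_apply, h1]
    exact (hq.monodromy_map P).symm
  have hbij (n : ℕ) : Function.Bijective
      fun τ : C(Simp n, E) => (q.comp τ, coord (τ (vertexZero n))) := by
    constructor
    · intro τ τ' hτ
      simp only [Prod.mk.injEq] at hτ
      refine lift_unique hq hτ.1 ?_
      have h1 := hcoord (τ (vertexZero n))
      have h2 := hcoord (τ' (vertexZero n))
      have h3 : q (τ (vertexZero n)) = q (τ' (vertexZero n)) := DFunLike.congr_fun hτ.1 _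
      rw [hτ.2] at h1
      have h4 : ((Ψ (q (τ (vertexZero n))) (coord (τ' (vertexZero n)))).1 : E) =
        (Ψ (q (τ' (vertexZero n))) (coord (τ' (vertexZero n)))).1 := by rw [h3]
      rwa [h1, h2] at h4
    · rintro ⟨σ, c⟩
      obtain ⟨τ, rfl, hτ⟩ := exists_lift hq σ (Ψ (σ (vertexZero n)) c).1
        (Ψ (σ (vertexZero n)) c).2
      refine ⟨τ, Prod.ext rfl ?_⟩
      apply (hΨ (q (τ (vertexZero n)))).1
      change Ψ (q (τ (vertexZero n))) (coord (τ (vertexZero n))) = _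
      rw [hcoord]
      exact Subtype.ext hτ
  refine ⟨fun n => Equiv.ofBijective _ (hbij n), fun n i τ => ?_⟩
  refine Prod.ext rfl ?_
  change coord (τ (faceMap n i (vertexZero n))) = if i = 0 then _ • coord (τ _) else coord (τ _)
  split_ifs with hi
  · subst hi
    exact hpath (.mk ((segmentPath (vertexZero (n + 1)) (faceMap n 0 (vertexZero n))).map
      τ.continuous))
  · rw [faceMap_vertexZero hi]

end Lift

/-! ### Comparing the homology of two covers of the same space -/

section Compare

variable {k : Type*} [Field k] {p : ℕ} [Fact p.Prime] [CharP k p]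
  {X : Type*} [TopologicalSpace X] {x₀ : X}

/-- The bundle of cosets over `X` itself, with cocycle the class of `simplexLoop` modulo `K`;
finiteness for `X` thus passes to its covers. -/
theorem finite_singularH_of_cover (γ : ∀ x, Path.Homotopic.Quotient x₀ x)
    {E : Type*} [TopologicalSpace E] {q : C(E, X)} {K : Subgroup (FundamentalGroup X x₀)} [K.Normal]
    [Finite (FundamentalGroup X x₀ ⧸ K)] (hp : IsPGroup p (FundamentalGroup X x₀ ⧸ K))
    (h : IsCoverAssociatedTo q K) (n : ℕ) [Module.Finite k (SingularH k X n)] :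
    Module.Finite k (SingularH k E n) := by
  obtain ⟨e, he⟩ := exists_simplices_equiv γ h
  have : Module.Finite k (H (M := fun n => C(Simp n, X) →₀ k)
    (fun n => simplicialD k k (face n)) n) := ‹Module.Finite k (SingularH k X n)›
  refine (finite_H_covering (k := k) (G := FundamentalGroup X x₀ ⧸ K) (T := fun n => C(Simp n, E))
    (S := fun n => C(Simp n, X)) (δ := face) (δT := face)
    (g := fun n σ => (simplexLoop γ n σ : FundamentalGroup X x₀ ⧸ K))
    hp (isPresimplicial_face E) e (fun n i τ => ?_) n).1
  rw [he, twistedFace]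
  congr 1

/-- Multiplicity of homology in a covering by a finite `p`-group, in characteristic `p`. -/
theorem finrank_singularH_le_of_covers (γ : ∀ x, Path.Homotopic.Quotient x₀ x)
    {E E' : Type*} [TopologicalSpace E] [TopologicalSpace E'] {q : C(E, X)} {q' : C(E', X)}
    {K K' : Subgroup (FundamentalGroup X x₀)} [K'.Normal] (hle : K' ≤ K)
    [Finite (K ⧸ K'.subgroupOf K)] (hp : IsPGroup p (K ⧸ K'.subgroupOf K))
    (h : IsCoverAssociatedTo q K) (h' : IsCoverAssociatedTo q' K') (n : ℕ)
    [Module.Finite k (SingularH k E n)] :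
    Module.finrank k (SingularH k E' n) ≤
      Nat.card (K ⧸ K'.subgroupOf K) * Module.finrank k (SingularH k E n) := by
  obtain ⟨e, he⟩ := exists_simplices_equiv γ h
  obtain ⟨e', he'⟩ := exists_simplices_equiv γ h'
  have : Module.Finite k (H (M := fun n => C(Simp n, E) →₀ k)
    (fun n => simplicialD k k (face n)) n) := ‹Module.Finite k (SingularH k E n)›
  -- A coset of `K'` is a coset of `K` together with an element of K/K', measured against a chosen
  -- representative.
  let Q := Subgroup.quotientEquivProdOfLE hle
  have hQ1 (c : FundamentalGroup X x₀) : (Q c).1 = c := rfl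
  have hQ2 (c : FundamentalGroup X x₀) (hc) : (Q c).2 =
    ((⟨(Quotient.out (c : FundamentalGroup X x₀ ⧸ K))⁻¹ * c, hc⟩ : K) : K ⧸ K'.subgroupOf K) := rfl
  -- This element measures how far `c` is from respecting the chosen representatives. It is the
  -- cocycle that twists the zeroth face over `E`.
  have hmem (c : FundamentalGroup X x₀) (a : FundamentalGroup X x₀ ⧸ K) :
      (Quotient.out (c • a))⁻¹ * c * Quotient.out a ∈ K := by
    rw [mul_assoc, ← QuotientGroup.eq]
    have h1 :
        ((Quotient.out (c • a) : FundamentalGroup X x₀) : FundamentalGroup X x₀ ⧸ K) = c • a :=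
      Quotient.out_eq _
    have h2 : ((Quotient.out a : FundamentalGroup X x₀) : FundamentalGroup X x₀ ⧸ K) = a :=
      Quotient.out_eq _
    rw [h1]
    conv_lhs => rw [← h2]
    rfl
  have hQ (c : FundamentalGroup X x₀) (a : FundamentalGroup X x₀ ⧸ K') :
      Q (c • a) = (c • (Q a).1, ((⟨_, hmem c (Q a).1⟩ : K) : K ⧸ K'.subgroupOf K) * (Q a).2) := by
    obtain ⟨a, rfl⟩ := QuotientGroup.mk_surjective a
    have h2 : ((Quotient.out (a : FundamentalGroup X x₀ ⧸ K) : FundamentalGroup X x₀) :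
      FundamentalGroup X x₀ ⧸ K) = a := Quotient.out_eq _
    have h3 : ((Quotient.out ((c * a : FundamentalGroup X x₀) : FundamentalGroup X x₀ ⧸ K) :
      FundamentalGroup X x₀) : FundamentalGroup X x₀ ⧸ K) = (c * a : FundamentalGroup X x₀) :=
      Quotient.out_eq _
    refine Prod.ext rfl ?_
    change (Q ((c * a : FundamentalGroup X x₀) : FundamentalGroup X x₀ ⧸ K')).2 = _
    rw [hQ2 _ (QuotientGroup.eq.1 h3), hQ2 _ (QuotientGroup.eq.1 h2), ← QuotientGroup.mk_mul]
    congr 1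
    ext1
    change _ = ((Quotient.out ((c * a : FundamentalGroup X x₀) : FundamentalGroup X x₀ ⧸ K))⁻¹ * c *
      Quotient.out (a : FundamentalGroup X x₀ ⧸ K)) *
        ((Quotient.out (a : FundamentalGroup X x₀ ⧸ K))⁻¹ * a)
    group
  let f (n : ℕ) : C(Simp n, E') ≃ C(Simp n, E) × (K ⧸ K'.subgroupOf K) :=
    (e' n).trans (((Equiv.refl _).prodCongr Q).trans ((Equiv.prodAssoc _ _ _).symm.trans
      ((e n).symm.prodCongr (Equiv.refl _))))
  let g (n : ℕ) (τ : C(Simp (n + 1), E)) : K ⧸ K'.subgroupOf K :=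
    ((⟨_, hmem (simplexLoop γ n (e (n + 1) τ).1) (e (n + 1) τ).2⟩ : K) : K ⧸ K'.subgroupOf K)
  refine (finite_H_covering (k := k) (T := fun n => C(Simp n, E'))
    (S := fun n => C(Simp n, E)) (δ := face) (δT := face)
    (g := g) hp (isPresimplicial_face E') f (fun n i τ => ?_) n).2
  have hf (n : ℕ) (τ : C(Simp n, E')) : f n τ = ((e n).symm ((e' n τ).1, (Q (e' n τ).2).1),
    (Q (e' n τ).2).2) := rfl
  rw [hf, hf, he', twistedFace]
  split_ifs with hi
  · subst hi
    rw [hQ]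
    refine Prod.ext ?_ ?_
    · rw [Equiv.symm_apply_eq, he]
      simp
    · simp only [g, Equiv.apply_symm_apply]
  · refine Prod.ext ?_ rfl
    rw [Equiv.symm_apply_eq, he]
    simp [hi]

end Compare

/-! ### Barycentric subdivision of tuples -/

section Tuples

variable (k : Type*) [Field k] {K K' : Type*}

/-- The differential of the augmented chain complex of tuples. -/
abbrev tupleD (K : Type*) (m : ℕ) : ((Fin (m + 1) → K) →₀ k) →ₗ[k] ((Fin m → K) →₀ k) :=
  simplicialD k k fun i w => Fin.removeNth i w

theorem tupleD_comp_tupleD (m : ℕ) : tupleD k K m ∘ₗ tupleD k K (m + 1) = 0 := by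
  refine twistedD_comp_twistedD _ _ _ _ (fun i j hij s => ?_) fun _ _ _ _ _ => rfl
  funext a
  simp only [Fin.removeNth]
  congr 1
  simp only [Fin.succAbove, Fin.lt_def, Fin.le_def] at hij ⊢
  grind

/-- The cone with a given apex. -/
abbrev tupleCone (b : K) (m : ℕ) : ((Fin m → K) →₀ k) →ₗ[k] ((Fin (m + 1) → K) →₀ k) :=
  Finsupp.lmapDomain k k (Fin.cons (α := fun _ => K) b)

theorem tupleD_tupleCone_zero (b : K) (y : (Fin 0 → K) →₀ k) :
    tupleD k K 0 (tupleCone k b 0 y) = y := by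
  induction y using Finsupp.induction_linear with
  | zero => simp
  | add x y hx hy => simp only [map_add, hx, hy]
  | single w c =>
    rw [Finsupp.lmapDomain_apply, Finsupp.mapDomain_single, simplicialD_single]
    simp only [Fin.sum_univ_succ, Fin.val_zero, pow_zero, one_smul, Finset.univ_eq_empty,
      Finset.sum_empty, add_zero]
    congr 1

theorem tupleD_tupleCone (b : K) (m : ℕ) (y : (Fin (m + 1) → K) →₀ k) :
    tupleD k K (m + 1) (tupleCone k b (m + 1) y) = y - tupleCone k b m (tupleD k K m y) := by
  induction y using Finsupp.induction_linear with
  | zero => simp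
  | add x y hx hy => simp only [map_add, hx, hy]; abel
  | single w c =>
    rw [Finsupp.lmapDomain_apply, Finsupp.mapDomain_single, simplicialD_single,
      Fin.sum_univ_succ, simplicialD_single, map_sum, sub_eq_add_neg, ← Finset.sum_neg_distrib]
    congr 1
    · simp [Fin.removeNth_zero, Fin.tail_cons]
    · refine Finset.sum_congr rfl fun i _ => ?_
      rw [map_smul, Finsupp.lmapDomain_apply, Finsupp.mapDomain_single, Fin.val_succ, pow_succ,
        mul_neg_one, neg_smul]
      congr 3
      funext a
      refine Fin.cases ?_ (fun a => ?_) a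
      · simp [Fin.removeNth]
      · simp [Fin.removeNth]

variable (β : ∀ m, (Fin (m + 1) → K) → K)

/-- The subdivision operator on tuples, with the given choice of barycentres. -/
def tupleSd : ∀ m, ((Fin m → K) →₀ k) →ₗ[k] ((Fin m → K) →₀ k)
  | 0 => LinearMap.id
  | m + 1 => Finsupp.lsum k fun w =>
      (tupleCone k (β m w) m ∘ₗ tupleSd m ∘ₗ tupleD k K m) ∘ₗ Finsupp.lsingle w

/-- The homotopy between subdivision and the identity. -/
def tupleT : ∀ m, ((Fin m → K) →₀ k) →ₗ[k] ((Fin (m + 1) → K) →₀ k)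
  | 0 => 0
  | m + 1 => Finsupp.lsum k fun w =>
      (tupleCone k (β m w) (m + 1) ∘ₗ (LinearMap.id - tupleT m ∘ₗ tupleD k K m)) ∘ₗ
        Finsupp.lsingle w

theorem tupleSd_single (m : ℕ) (w : Fin (m + 1) → K) (c : k) :
    tupleSd k β (m + 1) (Finsupp.single w c) =
      tupleCone k (β m w) m (tupleSd k β m (tupleD k K m (Finsupp.single w c))) := by
  simp only [tupleSd, Finsupp.lsum_single]
  rfl

theorem tupleT_single (m : ℕ) (w : Fin (m + 1) → K) (c : k) :
    tupleT k β (m + 1) (Finsupp.single w c) =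
      tupleCone k (β m w) (m + 1) (Finsupp.single w c -
        tupleT k β m (tupleD k K m (Finsupp.single w c))) := by
  simp only [tupleT, Finsupp.lsum_single]
  rfl

/-- Since ∂(b·y) = y − b·∂y, the unwanted term is the cone on ∂ sd ∂w = sd ∂∂w = 0. -/
theorem tupleD_tupleSd (m : ℕ) (y : (Fin (m + 1) → K) →₀ k) :
    tupleD k K m (tupleSd k β (m + 1) y) = tupleSd k β m (tupleD k K m y) := by
  induction m with
  | zero =>
    induction y using Finsupp.induction_linear with
    | zero => simp
    | add x y hx hy => simp only [map_add, hx, hy]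
    | single w c => rw [tupleSd_single, tupleD_tupleCone_zero]
  | succ m ih =>
    induction y using Finsupp.induction_linear with
    | zero => simp
    | add x y hx hy => simp only [map_add, hx, hy]
    | single w c =>
      rw [tupleSd_single, tupleD_tupleCone, ih]
      have := LinearMap.congr_fun (tupleD_comp_tupleD k (K := K) m) (Finsupp.single w c)
      rw [LinearMap.comp_apply] at this
      rw [this]
      simp

/-- By induction ∂(w − T∂w) = sd ∂w, and the cone on this is sd w; the cone formula then gives ∂Tw =
w − T∂w − sd w. -/
theorem tupleD_tupleT (m : ℕ) (y : (Fin (m + 1) → K) →₀ k) :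
    tupleD k K (m + 1) (tupleT k β (m + 1) y) =
      y - tupleSd k β (m + 1) y - tupleT k β m (tupleD k K m y) := by
  induction m with
  | zero =>
    induction y using Finsupp.induction_linear with
    | zero => simp
    | add x y hx hy => simp only [map_add, hx, hy]; abel
    | single w c =>
      rw [tupleT_single, tupleD_tupleCone, tupleSd_single]
      simp [tupleT, tupleSd]
  | succ m ih =>
    induction y using Finsupp.induction_linear with
    | zero => simp
    | add x y hx hy => simp only [map_add, hx, hy]; abel
    | single w c =>
      have := LinearMap.congr_fun (tupleD_comp_tupleD k (K := K) m) (Finsupp.single w c)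
      rw [LinearMap.comp_apply] at this
      rw [tupleT_single, tupleD_tupleCone, map_sub (tupleD k K (m + 1)), ih, tupleSd_single, this]
      simp only [map_sub, map_zero, LinearMap.zero_apply]
      abel

variable {k}

/-- The map on tuples induced by a map. -/
abbrev tupleMap (k : Type*) [Field k] (f : K → K') (m : ℕ) :
    ((Fin m → K) →₀ k) →ₗ[k] ((Fin m → K') →₀ k) :=
  Finsupp.lmapDomain k k (f ∘ ·)

theorem tupleMap_tupleD (f : K → K') (m : ℕ) (y : (Fin (m + 1) → K) →₀ k) :
    tupleMap k f m (tupleD k K m y) = tupleD k K' m (tupleMap k f (m + 1) y) := by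
  induction y using Finsupp.induction_linear with
  | zero => simp
  | add x y hx hy => simp only [map_add, hx, hy]
  | single w c =>
    rw [Finsupp.lmapDomain_apply, Finsupp.lmapDomain_apply, Finsupp.mapDomain_single,
      simplicialD_single, simplicialD_single, ← Finsupp.lmapDomain_apply k k, map_sum]
    refine Finset.sum_congr rfl fun i _ => ?_
    rw [map_smul, Finsupp.lmapDomain_apply, Finsupp.mapDomain_single]
    rfl

theorem tupleMap_tupleCone (f : K → K') (b : K) (m : ℕ) (y : (Fin m → K) →₀ k) :
    tupleMap k f (m + 1) (tupleCone k b m y) = tupleCone k (f b) m (tupleMap k f m y) := by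
  simp only [Finsupp.lmapDomain_apply, ← Finsupp.mapDomain_comp]
  congr 1
  funext w
  exact Fin.comp_cons (α := K) f b w

variable {β} {β' : ∀ m, (Fin (m + 1) → K') → K'}

/-- Affine maps preserve barycentres, so this naturality transports subdivision from the standard
simplex to every affine simplex. -/
theorem tupleMap_tupleSd {f : K → K'} (hf : ∀ m w, f (β m w) = β' m (f ∘ w)) (m : ℕ)
    (y : (Fin m → K) →₀ k) :
    tupleMap k f m (tupleSd k β m y) = tupleSd k β' m (tupleMap k f m y) := by
  induction m with
  | zero => rfl
  | succ m ih =>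
    induction y using Finsupp.induction_linear with
    | zero => simp
    | add x y hx hy => simp only [map_add, hx, hy]
    | single w c =>
      rw [tupleSd_single, tupleMap_tupleCone, ih, tupleMap_tupleD]
      simp only [Finsupp.lmapDomain_apply, Finsupp.mapDomain_single]
      rw [tupleSd_single, hf]
      simp

theorem tupleMap_tupleT {f : K → K'} (hf : ∀ m w, f (β m w) = β' m (f ∘ w)) (m : ℕ)
    (y : (Fin m → K) →₀ k) :
    tupleMap k f (m + 1) (tupleT k β m y) = tupleT k β' m (tupleMap k f m y) := by
  induction m with
  | zero => simp [tupleT]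
  | succ m ih =>
    induction y using Finsupp.induction_linear with
    | zero => simp
    | add x y hx hy => simp only [map_add, hx, hy]
    | single w c =>
      rw [tupleT_single, tupleMap_tupleCone, map_sub, ih, tupleMap_tupleD]
      simp only [Finsupp.lmapDomain_apply, Finsupp.mapDomain_single]
      rw [tupleT_single, hf]
      simp

/-- A property of tuples preserved by the steps of the subdivision holds in the support of the
subdivision. -/
theorem tupleSd_mem_supported (P : ∀ m, (Fin m → K) → Set (Fin m → K))
    (h0 : ∀ w, P 0 w = Set.univ)
    (hP : ∀ m w i, ∀ v ∈ P m (Fin.removeNth i w), Fin.cons (β m w) v ∈ P (m + 1) w)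
    (m : ℕ) (w : Fin m → K) (c : k) :
    tupleSd k β m (Finsupp.single w c) ∈ Finsupp.supported k k (P m w) := by
  induction m with
  | zero => rw [h0]; simp
  | succ m ih =>
    rw [tupleSd_single, simplicialD_single, map_sum, map_sum]
    refine Submodule.sum_mem _ fun i _ => ?_
    rw [map_smul, map_smul]
    refine Submodule.smul_mem _ _ ?_
    have h2 : Finsupp.supported k k (P m (Fin.removeNth i w)) ≤
        (Finsupp.supported k k (P (m + 1) w)).comap (tupleCone k (β m w) m) := by
      intro y hy
      classical
      rw [Submodule.mem_comap, Finsupp.mem_supported, Finsupp.lmapDomain_apply]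
      intro v hv
      obtain ⟨v', hv', rfl⟩ := Finset.mem_image.1 (Finsupp.mapDomain_support hv)
      exact hP m w i v' (hy hv')
    exact h2 (ih _)

end Tuples

/-! ### Affine simplices in the standard simplex -/

section Affine

variable {l m n : ℕ}

/-- The affine map between standard simplices with given values at the vertices. -/
def aff (w : Fin (m + 1) → Simp n) : C(Simp m, Simp n) where
  toFun t := ⟨∑ i, t.1 i • (w i).1, (convex_stdSimplex ℝ _).sum_mem (fun i _ => t.2.1 i) t.2.2
    fun i _ => (w i).2⟩
  continuous_toFun := by
    refine Continuous.subtype_mk (continuous_finsetSum _ fun i _ => ?_) _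
    exact ((continuous_apply i).comp continuous_subtype_val).smul continuous_const

theorem aff_val (w : Fin (m + 1) → Simp n) (t : Simp m) : (aff w t).1 = ∑ i, t.1 i • (w i).1 := rfl

theorem aff_aff (w' : Fin (m + 1) → Simp n) (w : Fin (l + 1) → Simp m) (t : Simp l) :
    aff w' (aff w t) = aff (aff w' ∘ w) t := by
  refine Subtype.ext ?_
  simp only [aff_val, Function.comp_apply, Finset.sum_apply, Pi.smul_apply, Finset.sum_smul,
    Finset.smul_sum, smul_smul, smul_eq_mul]
  exact Finset.sum_comm

/-- The tuple of vertices of the standard simplex. -/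
def vertices (n : ℕ) : Fin (n + 1) → Simp n := fun i => stdSimplex.vertex i

theorem vertices_val (i j : Fin (n + 1)) : (vertices n i).1 j = if j = i then 1 else 0 := by
  change (Pi.single i (1 : ℝ) : Fin (n + 1) → ℝ) j = _
  rw [Pi.single_apply]

theorem aff_vertices : aff (vertices n) = ContinuousMap.id _ := by
  refine ContinuousMap.ext fun t => Subtype.ext ?_
  funext j
  simp [aff_val, vertices_val]

theorem aff_comp_vertices (w : Fin (m + 1) → Simp n) : aff w ∘ vertices m = w := by
  funext i
  refine Subtype.ext ?_
  simp [aff_val, vertices_val]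

theorem faceMap_val_succAbove (n : ℕ) (i : Fin (n + 2)) (t : Simp n) (j : Fin (n + 1)) :
    (faceMap n i t).1 (i.succAbove j) = t.1 j := by
  change stdSimplex.map i.succAbove t (i.succAbove j) = _
  rw [stdSimplex.map_coe, FunOnFinite.linearMap_apply_apply,
    Finset.sum_eq_single_of_mem j (by simp)]
  · rfl
  · intro l hl hlj
    simp only [Finset.mem_filter, Finset.mem_univ, true_and] at hl
    exact absurd (Fin.succAbove_right_injective hl) hlj

theorem faceMap_val_self (n : ℕ) (i : Fin (n + 2)) (t : Simp n) : (faceMap n i t).1 i = 0 := by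
  change stdSimplex.map i.succAbove t i = _
  rw [stdSimplex.map_coe, FunOnFinite.linearMap_apply_apply]
  refine Finset.sum_eq_zero fun l hl => ?_
  simp at hl

theorem aff_comp_faceMap (w : Fin (m + 2) → Simp n) (i : Fin (m + 2)) :
    (aff w).comp (faceMap m i) = aff (Fin.removeNth i w) := by
  refine ContinuousMap.ext fun t => Subtype.ext ?_
  rw [ContinuousMap.comp_apply, aff_val, aff_val, Fin.sum_univ_succAbove _ i,
    faceMap_val_self, zero_smul, zero_add]
  simp only [faceMap_val_succAbove, Fin.removeNth]

theorem dist_aff_le (w : Fin (m + 1) → Simp n) (t : Simp m) (y : Simp n) :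
    dist y (aff w t) ≤ ∑ i, t.1 i * dist y (w i) := by
  simp only [Subtype.dist_eq, aff_val, dist_eq_norm]
  have : y.1 - ∑ i, t.1 i • (w i).1 = ∑ i, t.1 i • (y.1 - (w i).1) := by
    simp only [smul_sub, Finset.sum_sub_distrib, ← Finset.sum_smul]
    rw [show ∑ i, t.1 i = 1 from t.2.2, one_smul]
  rw [this]
  refine (norm_sum_le _ _).trans (Finset.sum_le_sum fun i _ => ?_)
  rw [norm_smul, Real.norm_of_nonneg (t.2.1 i)]

theorem dist_aff_le_of_forall (w : Fin (m + 1) → Simp n) (t : Simp m) (y : Simp n) {c : ℝ}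
    (h : ∀ i, dist y (w i) ≤ c) : dist y (aff w t) ≤ c := by
  refine (dist_aff_le w t y).trans ?_
  calc ∑ i, t.1 i * dist y (w i) ≤ ∑ i, t.1 i * c :=
        Finset.sum_le_sum fun i _ => mul_le_mul_of_nonneg_left (h i) (t.2.1 i)
    _ = c := by rw [← Finset.sum_mul, show ∑ i, t.1 i = 1 from t.2.2, one_mul]

/-- The barycentre of a tuple of points of the standard simplex. -/
def bary (n m : ℕ) (w : Fin (m + 1) → Simp n) : Simp n := aff w stdSimplex.barycenter

theorem aff_bary (w' : Fin (n + 1) → Simp l) (m : ℕ) (w : Fin (m + 1) → Simp n) :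
    aff w' (bary n m w) = bary l m (aff w' ∘ w) := aff_aff _ _ _

/-- All weights are 1/(m + 1), and the term of the vertex `w j` itself vanishes, leaving m terms of
size at most `D`. -/
theorem dist_bary_le (w : Fin (m + 1) → Simp n) {D : ℝ} (h : ∀ i j, dist (w i) (w j) ≤ D)
    (j : Fin (m + 1)) : dist (bary n m w) (w j) ≤ (m / (m + 1) : ℝ) * D := by
  rw [dist_comm]
  refine (dist_aff_le w _ _).trans ?_
  have hb : ∀ i, (stdSimplex.barycenter : Simp m).1 i = ((m : ℝ) + 1)⁻¹ := by
    intro i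
    rw [stdSimplex.barycenter_apply]
    simp
  simp only [hb]
  rw [← Finset.mul_sum, Fin.sum_univ_succAbove _ j, dist_self, zero_add, div_mul_eq_mul_div,
    div_eq_inv_mul]
  refine mul_le_mul_of_nonneg_left ?_ (by positivity)
  calc _ ≤ ∑ i : Fin m, D := Finset.sum_le_sum fun i _ => h _ _
    _ = m * D := by simp

end Affine

/-! ### Barycentric subdivision of singular chains -/

theorem tupleMap_single {k K K' : Type*} [Field k] (f : K → K') (m : ℕ) (w : Fin m → K) (c : k) :
    tupleMap k f m (Finsupp.single w c) = Finsupp.single (f ∘ w) c := by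
  rw [Finsupp.lmapDomain_apply, Finsupp.mapDomain_single]

/-! ### Subdivision shrinks diameters -/

section Mesh

variable (k : Type*) [Field k] (N : ℕ)

theorem tupleSd_bary_mem_supported {m : ℕ} {D : ℝ} (y : (Fin (m + 1) → Simp N) →₀ k)
    (hy : y ∈ Finsupp.supported k k {w : Fin (m + 1) → Simp N | ∀ i j, dist (w i) (w j) ≤ D}) :
    tupleSd k (bary N) (m + 1) y ∈ Finsupp.supported k k
      {w : Fin (m + 1) → Simp N | ∀ i j, dist (w i) (w j) ≤
        ((m + 1 : ℕ) / ((m + 1 : ℕ) + 1) : ℝ) * D} := by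
  rw [Finsupp.supported_eq_span_single] at hy
  induction hy using Submodule.span_induction with
  | zero => simp
  | add x y _ _ hx hy => rw [map_add]; exact add_mem hx hy
  | smul a x _ hx => rw [map_smul]; exact Submodule.smul_mem _ _ hx
  | mem x hx =>
    obtain ⟨w, hw, rfl⟩ := hx
    -- The invariant has two halves: new vertices lie in every closed ball containing the old ones,
    -- and distances shrink by m/(m + 1), with m the number of vertices. Counting vertices rather
    -- than dimension weakens the usual factor, but it stays below 1 and starts the recursion at the
    -- empty tuple.
    refine Finsupp.supported_mono ?_ (tupleSd_mem_supported (β := bary N)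
      (fun m w => {v | (∀ y c, (∀ j, dist y (w j) ≤ c) → ∀ i, dist y (v i) ≤ c) ∧
        ∀ D, (∀ i j, dist (w i) (w j) ≤ D) → ∀ i j, dist (v i) (v j) ≤ (m / (m + 1) : ℝ) * D})
      ?_ ?_ (m + 1) w 1)
    · rintro v ⟨-, hv⟩
      exact hv D hw
    · intro w
      refine Set.eq_univ_of_forall fun v => ⟨fun _ _ _ i => i.elim0, fun _ _ i => i.elim0⟩
    · rintro m w i v ⟨hv1, hv2⟩
      refine ⟨fun y c hc j => ?_, fun D hD => ?_⟩
      · refine Fin.cases ?_ (fun j => ?_) j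
        · exact dist_aff_le_of_forall _ _ _ hc
        · exact hv1 y c (fun j => hc _) j
      · have hD0 : 0 ≤ D := dist_nonneg.trans (hD 0 0)
        have hle : (m / (m + 1) : ℝ) * D ≤ ((m + 1 : ℕ) / ((m + 1 : ℕ) + 1) : ℝ) * D := by
          refine mul_le_mul_of_nonneg_right ?_ hD0
          rw [div_le_div_iff₀ (by positivity) (by positivity)]
          push_cast
          nlinarith
        have hb : ∀ j, dist (bary N m w) (v j) ≤ (m / (m + 1) : ℝ) * D := fun j =>
          hv1 _ _ (fun j => dist_bary_le w hD _) j
        intro a b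
        refine le_trans ?_ hle
        refine Fin.cases ?_ (fun a => ?_) a <;> refine Fin.cases ?_ (fun b => ?_) b
        · rw [dist_self]; positivity
        · exact hb b
        · rw [dist_comm]; exact hb a
        · exact hv2 D (fun _ _ => hD _ _) a b

theorem tupleSd_bary_iterate_mem_supported {m : ℕ} {D : ℝ} (r : ℕ) (y : (Fin (m + 1) → Simp N) →₀ k)
    (hy : y ∈ Finsupp.supported k k {w : Fin (m + 1) → Simp N | ∀ i j, dist (w i) (w j) ≤ D}) :
    (tupleSd k (bary N) (m + 1))^[r] y ∈ Finsupp.supported k k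
      {w : Fin (m + 1) → Simp N | ∀ i j, dist (w i) (w j) ≤
        ((m + 1 : ℕ) / ((m + 1 : ℕ) + 1) : ℝ) ^ r * D} := by
  induction r with
  | zero => simpa using hy
  | succ r ih =>
    rw [Function.iterate_succ_apply', pow_succ', mul_assoc]
    exact tupleSd_bary_mem_supported k N _ ih

end Mesh

section Subdivision

variable (k : Type*) [Field k] {X : Type*} [TopologicalSpace X]

theorem range_comp_subset {Y Z : Type*} [TopologicalSpace Y] [TopologicalSpace Z] (f : C(Z, X))
    (g : C(Y, Z)) {A : Set X} (h : Set.range f ⊆ A) : Set.range (f.comp g) ⊆ A := by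
  rintro _ ⟨y, rfl⟩
  exact h ⟨g y, rfl⟩

/-- The singular chains in a subset. -/
abbrev chainsIn (A : Set X) (n : ℕ) : Submodule k (C(Simp n, X) →₀ k) :=
  Finsupp.supported k k {σ | Set.range σ ⊆ A}

variable (X) in
/-- The singular cycles. -/
abbrev singularZ (n : ℕ) : Submodule k (C(Simp n, X) →₀ k) :=
  cycles (M := fun n => C(Simp n, X) →₀ k) (singularD k X) n

variable {k}

theorem singularD_apply_single (n : ℕ) (σ : C(Simp (n + 1), X)) (c : k) :
    singularD k X n (Finsupp.single σ c) =
      ∑ i : Fin (n + 2), (-1 : k) ^ (i : ℕ) • Finsupp.single (face n i σ) c :=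
  simplicialD_single ..

theorem singularD_mem_chainsIn {A : Set X} {n : ℕ} {x : C(Simp (n + 1), X) →₀ k}
    (hx : x ∈ chainsIn k A (n + 1)) : singularD k X n x ∈ chainsIn k A n := by
  rw [chainsIn, Finsupp.supported_eq_span_single] at hx
  induction hx using Submodule.span_induction with
  | zero => simp
  | add x y _ _ hx hy => rw [map_add]; exact add_mem hx hy
  | smul a x _ hx => rw [map_smul]; exact Submodule.smul_mem _ _ hx
  | mem x hx =>
    obtain ⟨σ, hσ, rfl⟩ := hx
    rw [singularD_apply_single]
    refine Submodule.sum_mem _ fun i _ => Submodule.smul_mem _ _ ?_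
    exact Finsupp.single_mem_supported _ _ (range_comp_subset σ _ hσ)

/-- The chain of affine simplices in a singular simplex given by a chain of tuples. -/
abbrev push (k : Type*) [Field k] {N : ℕ} (σ : C(Simp N, X)) (m : ℕ) :
    ((Fin (m + 1) → Simp N) →₀ k) →ₗ[k] (C(Simp m, X) →₀ k) :=
  Finsupp.lmapDomain k k fun w => σ.comp (aff w)

variable {N : ℕ} (σ : C(Simp N, X))

theorem push_mem_chainsIn {A : Set X} {m : ℕ} (h : Set.range σ ⊆ A)
    (y : (Fin (m + 1) → Simp N) →₀ k) : push k σ m y ∈ chainsIn k A m := by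
  induction y using Finsupp.induction_linear with
  | zero => simp
  | add x y hx hy => rw [map_add]; exact add_mem hx hy
  | single w c =>
    rw [Finsupp.lmapDomain_apply, Finsupp.mapDomain_single]
    exact Finsupp.single_mem_supported _ _ (range_comp_subset σ _ h)

theorem singularD_push (m : ℕ) (y : (Fin (m + 2) → Simp N) →₀ k) :
    singularD k X m (push k σ (m + 1) y) = push k σ m (tupleD k (Simp N) (m + 1) y) := by
  induction y using Finsupp.induction_linear with
  | zero => simp
  | add x y hx hy => simp only [map_add, hx, hy]
  | single w c =>
    rw [Finsupp.lmapDomain_apply, Finsupp.mapDomain_single, simplicialD_single,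
      singularD_apply_single, map_sum]
    refine Finset.sum_congr rfl fun i _ => ?_
    rw [map_smul, Finsupp.lmapDomain_apply, Finsupp.mapDomain_single, ← aff_comp_faceMap]
    rfl

theorem push_single_vertices (n : ℕ) (σ : C(Simp n, X)) (c : k) :
    push k σ n (Finsupp.single (vertices n) c) = Finsupp.single σ c := by
  rw [Finsupp.lmapDomain_apply, Finsupp.mapDomain_single, aff_vertices, ContinuousMap.comp_id]

theorem push_comp_aff {l m : ℕ} (w : Fin (l + 1) → Simp N) (y : (Fin (m + 1) → Simp l) →₀ k) :
    push k (σ.comp (aff w)) m y = push k σ m (tupleMap k (aff w) (m + 1) y) := by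
  simp only [Finsupp.lmapDomain_apply, ← Finsupp.mapDomain_comp]
  congr 1
  funext v
  refine ContinuousMap.ext fun t => ?_
  exact congrArg σ (aff_aff w v t)

variable (k X) in
/-- The barycentric subdivision. -/
def sd (n : ℕ) : (C(Simp n, X) →₀ k) →ₗ[k] (C(Simp n, X) →₀ k) :=
  Finsupp.lsum k fun σ => push k σ n ∘ₗ tupleSd k (bary n) (n + 1) ∘ₗ Finsupp.lsingle (vertices n)

variable (k X) in
/-- The homotopy between the barycentric subdivision and the identity. -/
def sdT (n : ℕ) : (C(Simp n, X) →₀ k) →ₗ[k] (C(Simp (n + 1), X) →₀ k) :=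
  Finsupp.lsum k fun σ =>
    push k σ (n + 1) ∘ₗ tupleT k (bary n) (n + 1) ∘ₗ Finsupp.lsingle (vertices n)

theorem sd_single (n : ℕ) (σ : C(Simp n, X)) (c : k) : sd k X n (Finsupp.single σ c) =
    push k σ n (tupleSd k (bary n) (n + 1) (Finsupp.single (vertices n) c)) := by
  rw [sd, Finsupp.lsum_single]
  rfl

theorem sdT_single (n : ℕ) (σ : C(Simp n, X)) (c : k) : sdT k X n (Finsupp.single σ c) =
    push k σ (n + 1) (tupleT k (bary n) (n + 1) (Finsupp.single (vertices n) c)) := by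
  rw [sdT, Finsupp.lsum_single]
  rfl

/-- Because of this, iterated subdivision of a singular simplex can be computed on tuples of points,
where the mesh estimate applies. -/
theorem sd_push (m : ℕ) (y : (Fin (m + 1) → Simp N) →₀ k) :
    sd k X m (push k σ m y) = push k σ m (tupleSd k (bary N) (m + 1) y) := by
  induction y using Finsupp.induction_linear with
  | zero => simp
  | add x y hx hy => simp only [map_add, hx, hy]
  | single w c =>
    rw [Finsupp.lmapDomain_apply, Finsupp.mapDomain_single, sd_single, push_comp_aff,
      tupleMap_tupleSd (β' := bary N) (aff_bary w), tupleMap_single, aff_comp_vertices]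

theorem sdT_push (m : ℕ) (y : (Fin (m + 1) → Simp N) →₀ k) :
    sdT k X m (push k σ m y) = push k σ (m + 1) (tupleT k (bary N) (m + 1) y) := by
  induction y using Finsupp.induction_linear with
  | zero => simp
  | add x y hx hy => simp only [map_add, hx, hy]
  | single w c =>
    rw [Finsupp.lmapDomain_apply, Finsupp.mapDomain_single, sdT_single, push_comp_aff,
      tupleMap_tupleT (β' := bary N) (aff_bary w), tupleMap_single, aff_comp_vertices]

theorem singularD_sd (n : ℕ) (x : C(Simp (n + 1), X) →₀ k) :
    singularD k X n (sd k X (n + 1) x) = sd k X n (singularD k X n x) := by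
  induction x using Finsupp.induction_linear with
  | zero => simp
  | add x y hx hy => simp only [map_add, hx, hy]
  | single σ c =>
    rw [sd_single, singularD_push, tupleD_tupleSd, ← sd_push, ← singularD_push,
      push_single_vertices]

/-- The identity for tuples, pushed forward along each singular simplex. -/
theorem singularD_sdT (n : ℕ) (x : C(Simp (n + 1), X) →₀ k) :
    singularD k X (n + 1) (sdT k X (n + 1) x) =
      x - sd k X (n + 1) x - sdT k X n (singularD k X n x) := by
  induction x using Finsupp.induction_linear with
  | zero => simp
  | add x y hx hy => simp only [map_add, hx, hy]; abel
  | single σ c =>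
    rw [sdT_single, singularD_push, tupleD_tupleT, map_sub, map_sub, ← sdT_push, ← singularD_push,
      push_single_vertices, sd_single]

theorem singularD_sdT_zero (x : C(Simp 0, X) →₀ k) :
    singularD k X 0 (sdT k X 0 x) = x - sd k X 0 x := by
  induction x using Finsupp.induction_linear with
  | zero => simp
  | add x y hx hy => simp only [map_add, hx, hy]; abel
  | single σ c =>
    rw [sdT_single, singularD_push, tupleD_tupleT, map_sub, map_sub, push_single_vertices,
      sd_single]
    simp [tupleT]

theorem singularD_sdT_of_mem_singularZ {n : ℕ} {x : C(Simp n, X) →₀ k} (hx : x ∈ singularZ k X n) :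
    singularD k X n (sdT k X n x) = x - sd k X n x := by
  cases n with
  | zero => exact singularD_sdT_zero x
  | succ n => rw [singularD_sdT, show singularD k X n x = 0 from hx, map_zero, sub_zero]

theorem sd_mem_singularZ {n : ℕ} {x : C(Simp n, X) →₀ k} (hx : x ∈ singularZ k X n) :
    sd k X n x ∈ singularZ k X n :=
  map_mem_cycles (M := fun n => C(Simp n, X) →₀ k) (N := fun n => C(Simp n, X) →₀ k)
    (sd k X) (fun n x => (singularD_sd n x).symm) n hx

theorem sd_mem_chainsIn {A : Set X} {n : ℕ} {x : C(Simp n, X) →₀ k} (hx : x ∈ chainsIn k A n) :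
    sd k X n x ∈ chainsIn k A n := by
  rw [chainsIn, Finsupp.supported_eq_span_single] at hx
  induction hx using Submodule.span_induction with
  | zero => simp
  | add x y _ _ hx hy => rw [map_add]; exact add_mem hx hy
  | smul a x _ hx => rw [map_smul]; exact Submodule.smul_mem _ _ hx
  | mem x hx =>
    obtain ⟨σ, hσ, rfl⟩ := hx
    rw [sd_single]
    exact push_mem_chainsIn σ hσ _

theorem sdT_mem_chainsIn {A : Set X} {n : ℕ} {x : C(Simp n, X) →₀ k} (hx : x ∈ chainsIn k A n) :
    sdT k X n x ∈ chainsIn k A (n + 1) := by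
  rw [chainsIn, Finsupp.supported_eq_span_single] at hx
  induction hx using Submodule.span_induction with
  | zero => simp
  | add x y _ _ hx hy => rw [map_add]; exact add_mem hx hy
  | smul a x _ hx => rw [map_smul]; exact Submodule.smul_mem _ _ hx
  | mem x hx =>
    obtain ⟨σ, hσ, rfl⟩ := hx
    rw [sdT_single]
    exact push_mem_chainsIn σ hσ _

theorem sd_iterate_single (n r : ℕ) (σ : C(Simp n, X)) (c : k) :
    (sd k X n)^[r] (Finsupp.single σ c) =
      push k σ n ((tupleSd k (bary n) (n + 1))^[r] (Finsupp.single (vertices n) c)) := by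
  induction r with
  | zero => exact (push_single_vertices n σ c).symm
  | succ r ih => rw [Function.iterate_succ_apply', ih, sd_push, Function.iterate_succ_apply']

theorem sd_iterate_mem_of_le {V₁ V₂ : Set X} {n r s : ℕ} (hrs : r ≤ s) {x : C(Simp n, X) →₀ k}
    (hx : (sd k X n)^[r] x ∈ chainsIn k V₁ n ⊔ chainsIn k V₂ n) :
    (sd k X n)^[s] x ∈ chainsIn k V₁ n ⊔ chainsIn k V₂ n := by
  induction s, hrs using Nat.le_induction with
  | base => exact hx
  | succ s _ ih =>
    rw [Function.iterate_succ_apply']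
    obtain ⟨a, ha, b, hb, h⟩ := Submodule.mem_sup.1 ih
    rw [← h, map_add]
    exact Submodule.add_mem_sup (sd_mem_chainsIn ha) (sd_mem_chainsIn hb)

/-- Pull the cover back to the simplex and take a Lebesgue number; the mesh of the iterates tends to
0, so each small affine simplex lies in one of the two sets. A finite sum needs only the largest of
the required numbers of iterations, as further subdivision does no harm. -/
theorem exists_sd_iterate_mem {V₁ V₂ : Set X} (h₁ : IsOpen V₁) (h₂ : IsOpen V₂) {n : ℕ}
    {x : C(Simp n, X) →₀ k} (hx : x ∈ chainsIn k (V₁ ∪ V₂) n) :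
    ∃ r, (sd k X n)^[r] x ∈ chainsIn k V₁ n ⊔ chainsIn k V₂ n := by
  rw [chainsIn, Finsupp.supported_eq_span_single] at hx
  induction hx using Submodule.span_induction with
  | zero => exact ⟨0, by simp⟩
  | add x y _ _ hx hy =>
    obtain ⟨r, hr⟩ := hx
    obtain ⟨s, hs⟩ := hy
    refine ⟨max r s, ?_⟩
    rw [← Module.End.pow_apply, map_add, Module.End.pow_apply, Module.End.pow_apply]
    exact add_mem (sd_iterate_mem_of_le (le_max_left _ _) hr)
      (sd_iterate_mem_of_le (le_max_right _ _) hs)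
  | smul a x _ hx =>
    obtain ⟨r, hr⟩ := hx
    refine ⟨r, ?_⟩
    rw [← Module.End.pow_apply, map_smul, Module.End.pow_apply]
    exact Submodule.smul_mem _ _ hr
  | mem x hx =>
    obtain ⟨σ, hσ, rfl⟩ := hx
    obtain ⟨δ, hδ, hball⟩ := lebesgue_number_lemma_of_metric (s := (Set.univ : Set (Simp n)))
      (c := fun b : Bool => σ ⁻¹' (if b then V₁ else V₂)) isCompact_univ
      (by rintro (_ | _) <;> simp [h₁.preimage σ.continuous, h₂.preimage σ.continuous])
      (by
        intro t _
        rcases hσ ⟨t, rfl⟩ with h | h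
        · exact Set.mem_iUnion.2 ⟨true, by simpa using h⟩
        · exact Set.mem_iUnion.2 ⟨false, by simpa using h⟩)
    obtain ⟨D, hD⟩ : ∃ D : ℝ, ∀ i j, dist (vertices n i) (vertices n j) ≤ D :=
      ⟨Metric.diam (Set.univ : Set (Simp n)), fun i j =>
        Metric.dist_le_diam_of_mem isCompact_univ.isBounded trivial trivial⟩
    have hρ : (((n + 1 : ℕ) / ((n + 1 : ℕ) + 1) : ℝ)) < 1 := by
      rw [div_lt_one (by positivity)]; linarith
    have hlim := (tendsto_pow_atTop_nhds_zero_of_lt_one (by positivity) hρ).mul_const D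
    rw [zero_mul] at hlim
    obtain ⟨r, hr⟩ := (hlim.eventually_lt_const hδ).exists
    refine ⟨r, ?_⟩
    have key := tupleSd_bary_iterate_mem_supported k n r (Finsupp.single (vertices n) 1)
      (Finsupp.single_mem_supported k _ hD)
    rw [sd_iterate_single]
    generalize (tupleSd k (bary n) (n + 1))^[r] (Finsupp.single (vertices n) 1) = y at key
    rw [Finsupp.supported_eq_span_single] at key
    induction key using Submodule.span_induction with
    | zero => simp
    | add x y _ _ hx hy => rw [map_add]; exact add_mem hx hy
    | smul a x _ hx => rw [map_smul]; exact Submodule.smul_mem _ _ hx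
    | mem x hx =>
      obtain ⟨w, hw, rfl⟩ := hx
      rw [Finsupp.lmapDomain_apply, Finsupp.mapDomain_single]
      obtain ⟨b, hb⟩ := hball (w 0) trivial
      have hsub : Set.range (σ.comp (aff w)) ⊆ if b then V₁ else V₂ := by
        rintro _ ⟨t, rfl⟩
        refine hb ?_
        rw [Metric.mem_ball, dist_comm]
        exact (dist_aff_le_of_forall w t _ fun i => hw 0 i).trans_lt hr
      cases b
      · exact Submodule.mem_sup_right (Finsupp.single_mem_supported _ _ hsub)
      · exact Submodule.mem_sup_left (Finsupp.single_mem_supported _ _ hsub)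

/-- A cycle in the union of two open sets is homologous to a sum of chains in these open sets. -/
theorem exists_eq_add_add_singularD {V₁ V₂ : Set X} (h₁ : IsOpen V₁) (h₂ : IsOpen V₂) {n : ℕ}
    {x : C(Simp n, X) →₀ k} (hx : x ∈ singularZ k X n) (hx' : x ∈ chainsIn k (V₁ ∪ V₂) n) :
    ∃ a ∈ chainsIn k V₁ n, ∃ b ∈ chainsIn k V₂ n, ∃ e ∈ chainsIn k (V₁ ∪ V₂) (n + 1),
      x = a + b + singularD k X n e := by
  obtain ⟨r, hr⟩ := exists_sd_iterate_mem h₁ h₂ hx'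
  induction r generalizing x with
  | zero =>
    obtain ⟨a, ha, b, hb, h⟩ := Submodule.mem_sup.1 hr
    exact ⟨a, ha, b, hb, 0, zero_mem _, by rw [map_zero, add_zero, h]; rfl⟩
  | succ r ih =>
    obtain ⟨a, ha, b, hb, e, he, h⟩ := ih (sd_mem_singularZ hx) (sd_mem_chainsIn hx') hr
    -- A cycle differs from its subdivision by the boundary of `sdT`, which stays in V₁ ∪ V₂.
    refine ⟨a, ha, b, hb, e + sdT k X n x, add_mem he (sdT_mem_chainsIn hx'), ?_⟩
    rw [map_add, singularD_sdT_of_mem_singularZ hx, ← add_assoc, ← h]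
    abel

end Subdivision

/-! ### Finiteness of the homology of locally acyclic compact spaces -/

section LinearAlgebra

variable {k A B : Type*} [Field k] [AddCommGroup A] [Module k A] [AddCommGroup B] [Module k B]

theorem exists_fg_le_map_eq (f : A →ₗ[k] B) (L : Submodule k A) (h : (L.map f).FG) :
    ∃ F ≤ L, F.FG ∧ F.map f = L.map f := by
  classical
  obtain ⟨S, hS⟩ := h
  have hsub : (S : Set B) ⊆ f '' L := by
    rw [← Submodule.map_coe, ← hS]
    exact Submodule.subset_span
  obtain ⟨T, hT, rfl⟩ := Finset.subset_set_image_iff.1 hsub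
  refine ⟨Submodule.span k T, Submodule.span_le.2 hT, ⟨T, rfl⟩, ?_⟩
  rw [Submodule.map_span, ← hS, Finset.coe_image]

/-- `L` has finite-dimensional image modulo `K`, and generators of that image lift to `L`. So
finitely many generators modulo `K` can be chosen in `L` itself. -/
theorem exists_fg_le_le_sup {L F K : Submodule k A} (hF : F.FG) (h : L ≤ F ⊔ K) :
    ∃ F₁ ≤ L, F₁.FG ∧ L ≤ F₁ ⊔ K := by
  have h1 : (L.map K.mkQ).FG := by
    have hFG : (F.map K.mkQ).FG := hF.map _
    have hle : L.map K.mkQ ≤ F.map K.mkQ := by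
      refine (Submodule.map_mono h).trans ?_
      rw [Submodule.map_sup, Submodule.mkQ_map_self, sup_bot_eq]
    have : Module.Finite k (F.map K.mkQ) := Module.Finite.iff_fg.2 hFG
    exact Module.Finite.iff_fg.1 (Submodule.finiteDimensional_of_le hle)
  obtain ⟨F₁, hle, hfg, he⟩ := exists_fg_le_map_eq _ _ h1
  refine ⟨F₁, hle, hfg, ?_⟩
  have := Submodule.le_comap_map K.mkQ L
  rwa [← he, Submodule.comap_map_mkQ, sup_comm] at this

theorem mem_sup_of_le_left {F F' K : Submodule k A} (h : F ≤ F') {x : A} (hx : x ∈ F ⊔ K) :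
    x ∈ F' ⊔ K :=
  (sup_le_sup_right h K : F ⊔ K ≤ F' ⊔ K) hx

end LinearAlgebra

section FiniteRank

variable (k : Type*) [Field k] {X : Type*} [TopologicalSpace X]

/-- The map on `n`-th homology from `V` to `U` has finite rank. -/
def FiniteRank (n : ℕ) (V U : Set X) : Prop :=
  ∃ F : Submodule k (C(Simp n, X) →₀ k), F.FG ∧
    singularZ k X n ⊓ chainsIn k V n ≤ F ⊔ (chainsIn k U (n + 1)).map (singularD k X n)

variable {k}

theorem chainsIn_mono {V U : Set X} (h : V ⊆ U) (n : ℕ) : chainsIn k V n ≤ chainsIn k U n :=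
  Finsupp.supported_mono fun _ hσ => hσ.trans h

theorem FiniteRank.mono {n : ℕ} {V U V' U' : Set X} (h : FiniteRank k n V U) (hV : V' ⊆ V)
    (hU : U ⊆ U') : FiniteRank k n V' U' := by
  obtain ⟨F, hF, h⟩ := h
  exact ⟨F, hF, (inf_le_inf_left _ (chainsIn_mono hV n)).trans
    (h.trans (sup_le_sup_left (Submodule.map_mono (chainsIn_mono hU _)) _))⟩

theorem finiteRank_empty (n : ℕ) (U : Set X) : FiniteRank k n ∅ U := by
  refine ⟨⊥, Submodule.fg_bot, ?_⟩
  rintro x ⟨-, hx⟩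
  have : {σ : C(Simp n, X) | Set.range σ ⊆ ∅} = ∅ := by
    refine Set.eq_empty_of_forall_notMem fun σ hσ => ?_
    exact hσ ⟨stdSimplex.barycenter, rfl⟩
  rw [SetLike.mem_coe, chainsIn, this, Finsupp.supported_empty] at hx
  rw [(Submodule.mem_bot k).1 hx]
  exact zero_mem _

theorem singularD_mem_singularZ (n : ℕ) (x : C(Simp (n + 1), X) →₀ k) :
    singularD k X n x ∈ singularZ k X n :=
  mem_cycles_of_comp_eq_zero (M := fun n => C(Simp n, X) →₀ k) singularD_comp_singularD n x

theorem FiniteRank.union_zero {V₁ V₂ U : Set X} (o₁ : IsOpen V₁) (o₂ : IsOpen V₂)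
    (hU : V₁ ∪ V₂ ⊆ U) (h₁ : FiniteRank k 0 V₁ U) (h₂ : FiniteRank k 0 V₂ U) :
    FiniteRank k 0 (V₁ ∪ V₂) U := by
  obtain ⟨F₁, f₁, h₁⟩ := h₁
  obtain ⟨F₂, f₂, h₂⟩ := h₂
  refine ⟨F₁ ⊔ F₂, f₁.sup f₂, ?_⟩
  rintro x ⟨hx, hx'⟩
  obtain ⟨a, ha, b, hb, e, he, rfl⟩ := exists_eq_add_add_singularD o₁ o₂ hx hx'
  refine add_mem (add_mem ?_ ?_) ?_
  · exact mem_sup_of_le_left le_sup_left (h₁ ⟨trivial, ha⟩)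
  · exact mem_sup_of_le_left le_sup_right (h₂ ⟨trivial, hb⟩)
  · exact Submodule.mem_sup_right ⟨e, chainsIn_mono hU _ he, rfl⟩

/-- Mayer–Vietoris: split a cycle as a + b up to a boundary. Then ∂a = −∂b is a cycle in V₁ ∩ V₂, so
up to a finite-dimensional choice it bounds some `c` in W₁ ∩ W₂, and correcting by `c` yields cycles
in W₁ and W₂. -/
theorem FiniteRank.union_succ {n : ℕ} {V₁ V₂ W₁ W₂ U : Set X} (o₁ : IsOpen V₁) (o₂ : IsOpen V₂)
    (hV₁ : V₁ ⊆ W₁) (hV₂ : V₂ ⊆ W₂) (hU : V₁ ∪ V₂ ⊆ U)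
    (h₀ : FiniteRank k n (V₁ ∩ V₂) (W₁ ∩ W₂))
    (h₁ : FiniteRank k (n + 1) W₁ U) (h₂ : FiniteRank k (n + 1) W₂ U) :
    FiniteRank k (n + 1) (V₁ ∪ V₂) U := by
  obtain ⟨F₀, f₀, h₀⟩ := h₀
  obtain ⟨F₁, f₁, h₁⟩ := h₁
  obtain ⟨F₂, f₂, h₂⟩ := h₂
  have hL : (chainsIn k V₁ (n + 1)).map (singularD k X n) ⊓
      (chainsIn k V₂ (n + 1)).map (singularD k X n) ≤
        F₀ ⊔ (chainsIn k (W₁ ∩ W₂) (n + 1)).map (singularD k X n) := by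
    rintro _ ⟨⟨a, ha, rfl⟩, ⟨b, hb, hab⟩⟩
    refine h₀ ⟨singularD_mem_singularZ n a, fun σ hσ => Set.subset_inter ?_ ?_⟩
    · exact singularD_mem_chainsIn ha hσ
    · rw [← hab] at hσ
      exact singularD_mem_chainsIn hb hσ
  obtain ⟨F, hFle, hF, hL⟩ := exists_fg_le_le_sup f₀ hL
  -- `F` consists of boundaries from both sides, so it has finite-dimensional lifts to chains in V₁
  -- and in V₂; these absorb the part of ∂a that does not bound in W₁ ∩ W₂.
  have key : ∀ V : Set X, F ≤ (chainsIn k V (n + 1)).map (singularD k X n) →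
      ∃ G ≤ chainsIn k V (n + 1), G.FG ∧ G.map (singularD k X n) = F := by
    intro V hV
    have e : (chainsIn k V (n + 1) ⊓ F.comap (singularD k X n)).map (singularD k X n) = F := by
      refine le_antisymm ?_ fun y hy => ?_
      · rintro _ ⟨y, hy, rfl⟩
        exact hy.2
      · obtain ⟨z, hz, rfl⟩ := hV hy
        exact ⟨z, ⟨hz, hy⟩, rfl⟩
    obtain ⟨G, hG, hG', h⟩ := exists_fg_le_map_eq (singularD k X n)
      (chainsIn k V (n + 1) ⊓ F.comap (singularD k X n)) (by rwa [e])
    exact ⟨G, hG.trans inf_le_left, hG', h.trans e⟩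
  obtain ⟨G₁, hG₁, g₁, e₁⟩ := key V₁ (hFle.trans inf_le_left)
  obtain ⟨G₂, hG₂, g₂, e₂⟩ := key V₂ (hFle.trans inf_le_right)
  refine ⟨(F₁ ⊔ F₂) ⊔ (G₁ ⊔ G₂), (f₁.sup f₂).sup (g₁.sup g₂), ?_⟩
  rintro x ⟨hx, hx'⟩
  obtain ⟨a, ha, b, hb, e, he, rfl⟩ := exists_eq_add_add_singularD o₁ o₂ hx hx'
  have hda : singularD k X n a = singularD k X n (-b) := by
    have h3 : singularD k X n (a + b + singularD k X (n + 1) e) = 0 := hx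
    have h4 : singularD k X n (singularD k X (n + 1) e) = 0 :=
      LinearMap.congr_fun (singularD_comp_singularD n) e
    rw [map_add, h4, add_zero, map_add] at h3
    rw [map_neg]
    exact eq_neg_of_add_eq_zero_left h3
  obtain ⟨f, hf, _, ⟨c, hc, rfl⟩, hfc⟩ := Submodule.mem_sup.1
    (hL ⟨⟨a, ha, rfl⟩, ⟨-b, neg_mem hb, hda.symm⟩⟩)
  obtain ⟨a₁, ha₁, hfa⟩ : f ∈ G₁.map (singularD k X n) := e₁ ▸ hf
  obtain ⟨b₁, hb₁, hfb⟩ : f ∈ G₂.map (singularD k X n) := e₂ ▸ hf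
  have hac : a - a₁ - c ∈ F₁ ⊔ (chainsIn k U (n + 2)).map (singularD k X (n + 1)) := by
    refine h₁ ⟨?_, ?_⟩
    · change singularD k X n _ = 0
      rw [map_sub, map_sub, ← hfc, hfa]
      abel
    · exact sub_mem (sub_mem (chainsIn_mono hV₁ _ ha) (chainsIn_mono hV₁ _ (hG₁ ha₁)))
        (chainsIn_mono Set.inter_subset_left _ hc)
  have hbc : b + b₁ + c ∈ F₂ ⊔ (chainsIn k U (n + 2)).map (singularD k X (n + 1)) := by
    refine h₂ ⟨?_, ?_⟩
    · change singularD k X n _ = 0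
      rw [map_add, map_add, hfb, add_assoc, hfc, hda, map_neg, add_neg_cancel]
    · exact add_mem (add_mem (chainsIn_mono hV₂ _ hb) (chainsIn_mono hV₂ _ (hG₂ hb₁)))
        (chainsIn_mono Set.inter_subset_right _ hc)
  -- Two cycles controlled by `h₁` and `h₂`, an element of G₁ + G₂, and a boundary.
  have hdecomp : a + b + singularD k X (n + 1) e =
      (a - a₁ - c) + (b + b₁ + c) + (a₁ - b₁) + singularD k X (n + 1) e := by abel
  rw [hdecomp]
  refine add_mem (add_mem (add_mem ?_ ?_) ?_) ?_
  · exact mem_sup_of_le_left (le_sup_left.trans le_sup_left) hac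
  · exact mem_sup_of_le_left (le_sup_right.trans le_sup_left) hbc
  · exact Submodule.mem_sup_left (Submodule.mem_sup_right
      (sub_mem (Submodule.mem_sup_left ha₁) (Submodule.mem_sup_right hb₁)))
  · exact Submodule.mem_sup_right ⟨e, chainsIn_mono hU _ he, rfl⟩

/-- Induction on the degree, then compactness of `K`. Requiring `V` to contain the closure of `s`
leaves room to shrink when two pieces are united: normality gives smaller V₁ and V₂, and the lower
degree applies to the compact intersection of their closures. -/
theorem exists_isOpen_finiteRank [T2Space X] [CompactSpace X]
    (hloc : ∀ n, ∀ x : X, ∀ U, IsOpen U → x ∈ U →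
      ∃ V, IsOpen V ∧ x ∈ V ∧ V ⊆ U ∧ FiniteRank k n V U)
    (n : ℕ) (K U : Set X) (hK : IsCompact K) (hU : IsOpen U) (hKU : K ⊆ U) :
    ∃ V, IsOpen V ∧ K ⊆ V ∧ V ⊆ U ∧ FiniteRank k n V U := by
  induction n generalizing K U with
  | zero =>
    refine Exists.imp (fun V h => ⟨h.1, subset_closure.trans h.2.1, h.2.2⟩)
      (hK.induction_on (p := fun s => ∃ V, IsOpen V ∧ closure s ⊆ V ∧ V ⊆ U ∧ FiniteRank k 0 V U)
        ?_ ?_ ?_ ?_)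
    · exact ⟨∅, isOpen_empty, by simp, by simp, finiteRank_empty _ _⟩
    · rintro s t hst ⟨V, h1, h2, h3⟩
      exact ⟨V, h1, (closure_mono hst).trans h2, h3⟩
    · rintro s t ⟨V₁, o₁, s₁, u₁, h₁⟩ ⟨V₂, o₂, s₂, u₂, h₂⟩
      exact ⟨V₁ ∪ V₂, o₁.union o₂, closure_union.trans_subset (Set.union_subset_union s₁ s₂),
        Set.union_subset u₁ u₂, h₁.union_zero o₁ o₂ (Set.union_subset u₁ u₂) h₂⟩
    · intro x hx
      obtain ⟨V, hV, hxV, hVU, h⟩ := hloc 0 x U hU (hKU hx)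
      obtain ⟨t, ht, htc, htV⟩ := exists_mem_nhds_isClosed_subset (hV.mem_nhds hxV)
      exact ⟨t, mem_nhdsWithin_of_mem_nhds ht, V, hV, by rwa [htc.closure_eq], hVU, h⟩
  | succ n ih =>
    refine Exists.imp (fun V h => ⟨h.1, subset_closure.trans h.2.1, h.2.2⟩)
      (hK.induction_on
        (p := fun s => ∃ V, IsOpen V ∧ closure s ⊆ V ∧ V ⊆ U ∧ FiniteRank k (n + 1) V U)
        ?_ ?_ ?_ ?_)
    · exact ⟨∅, isOpen_empty, by simp, by simp, finiteRank_empty _ _⟩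
    · rintro s t hst ⟨V, h1, h2, h3⟩
      exact ⟨V, h1, (closure_mono hst).trans h2, h3⟩
    · rintro s t ⟨W₁, o₁, s₁, u₁, h₁⟩ ⟨W₂, o₂, s₂, u₂, h₂⟩
      obtain ⟨V₁, v₁, t₁, w₁⟩ := normal_exists_closure_subset isClosed_closure o₁ s₁
      obtain ⟨V₂, v₂, t₂, w₂⟩ := normal_exists_closure_subset isClosed_closure o₂ s₂
      obtain ⟨W, hW, hVW, -, h⟩ := ih (closure V₁ ∩ closure V₂) (W₁ ∩ W₂)
        (isClosed_closure.inter isClosed_closure).isCompact (o₁.inter o₂)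
        (Set.inter_subset_inter w₁ w₂)
      have i₁ := subset_closure.trans w₁
      have i₂ := subset_closure.trans w₂
      have hsub : V₁ ∪ V₂ ⊆ U := Set.union_subset (i₁.trans u₁) (i₂.trans u₂)
      exact ⟨V₁ ∪ V₂, v₁.union v₂, closure_union.trans_subset (Set.union_subset_union t₁ t₂), hsub,
        FiniteRank.union_succ v₁ v₂ i₁ i₂ hsub
          (h.mono ((Set.inter_subset_inter subset_closure subset_closure).trans hVW) subset_rfl)
          h₁ h₂⟩
    · intro x hx
      obtain ⟨V, hV, hxV, hVU, h⟩ := hloc (n + 1) x U hU (hKU hx)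
      obtain ⟨t, ht, htc, htV⟩ := exists_mem_nhds_isClosed_subset (hV.mem_nhds hxV)
      exact ⟨t, mem_nhdsWithin_of_mem_nhds ht, V, hV, by rwa [htc.closure_eq], hVU, h⟩

theorem finite_singularH_of_finiteRank {n : ℕ} (h : FiniteRank k n (Set.univ : Set X) Set.univ) :
    Module.Finite k (SingularH k X n) := by
  obtain ⟨F, hF, h⟩ := h
  have hle : singularZ k X n ≤ F ⊔ LinearMap.range (singularD k X n) := by
    intro x hx
    have h1 := h ⟨hx, fun _ _ => Set.subset_univ _⟩
    rw [sup_comm] at h1 ⊢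
    exact mem_sup_of_le_left LinearMap.map_le_range h1
  -- `F` need not consist of cycles; it is replaced by a finite-dimensional space of cycles, which
  -- then surjects onto homology.
  obtain ⟨F₁, hF₁, hfg, hle⟩ := exists_fg_le_le_sup hF hle
  have : Module.Finite k F₁ := Module.Finite.iff_fg.2 hfg
  refine Module.Finite.of_surjective ((Submodule.mkQ _) ∘ₗ Submodule.inclusion hF₁ :
    F₁ →ₗ[k] SingularH k X n) fun x => ?_
  obtain ⟨⟨x, hx⟩, rfl⟩ := Submodule.Quotient.mk_surjective _ x
  obtain ⟨f, hf, _, ⟨y, rfl⟩, rfl⟩ := Submodule.mem_sup.1 (hle hx)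
  refine ⟨⟨f, hf⟩, ?_⟩
  change Submodule.Quotient.mk _ = _
  rw [Submodule.Quotient.eq]
  exact ⟨-y, by simp⟩

end FiniteRank

/-! ### The cone construction -/

/-- The map contracting a standard simplex to the additional vertex of the next one. -/
def join (n : ℕ) : C(Simp n × unitInterval, Simp (n + 1)) where
  toFun p := ⟨Fin.cons (p.2 : ℝ) ((1 - p.2 : ℝ) • p.1.1), by
    constructor
    · intro i
      refine Fin.cases ?_ (fun i => ?_) i
      · exact p.2.2.1
      · exact mul_nonneg (sub_nonneg.2 p.2.2.2) (p.1.2.1 i)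
    · rw [Fin.sum_univ_succ]
      simp only [Fin.cons_zero, Fin.cons_succ, Pi.smul_apply, smul_eq_mul]
      rw [← Finset.mul_sum, show ∑ i, p.1.1 i = 1 from p.1.2.2]
      ring⟩
  continuous_toFun := by
    refine Continuous.subtype_mk (continuous_pi fun i => ?_) _
    refine Fin.cases ?_ (fun i => ?_) i
    · exact continuous_subtype_val.comp continuous_snd
    · simp only [Fin.cons_succ, Pi.smul_apply, smul_eq_mul]
      have : Continuous fun p : Simp n × unitInterval => p.1.1 i :=
        (continuous_apply i).comp (continuous_subtype_val.comp continuous_fst)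
      fun_prop

theorem join_val_zero (n : ℕ) (t : Simp n) (r : unitInterval) : (join n (t, r)).1 0 = r := rfl

theorem join_val_succ (n : ℕ) (t : Simp n) (r : unitInterval) (i : Fin (n + 1)) :
    (join n (t, r)).1 i.succ = (1 - r) * t.1 i := rfl

theorem join_surjective (n : ℕ) : Function.Surjective (join n) := by
  intro s
  have hs := s.2.2
  rw [Fin.sum_univ_succ] at hs
  have h0 : 0 ≤ ∑ i : Fin (n + 1), s.1 i.succ := Finset.sum_nonneg fun i _ => s.2.1 _
  have hI : s.1 0 ∈ unitInterval := ⟨s.2.1 0, by linarith⟩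
  by_cases h1 : s.1 0 = 1
  · refine ⟨(stdSimplex.barycenter, 1), Subtype.ext (funext fun i => ?_)⟩
    have h2 : ∀ i : Fin (n + 1), s.1 i.succ = 0 := fun i =>
      (Finset.sum_eq_zero_iff_of_nonneg fun i _ => s.2.1 _).1 (by linarith) i (Finset.mem_univ i)
    refine Fin.cases ?_ (fun i => ?_) i
    · rw [join_val_zero, h1]; rfl
    · rw [join_val_succ, h2]; simp
  · have h3 : 1 - s.1 0 ≠ 0 := sub_ne_zero.2 (Ne.symm h1)
    refine ⟨(⟨fun i => (1 - s.1 0)⁻¹ * s.1 i.succ, fun i => ?_, ?_⟩, ⟨s.1 0, hI⟩),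
      Subtype.ext (funext fun i => ?_)⟩
    · exact mul_nonneg (inv_nonneg.2 (sub_nonneg.2 hI.2)) (s.2.1 _)
    · rw [← Finset.mul_sum, show ∑ i : Fin (n + 1), s.1 i.succ = 1 - s.1 0 by linarith,
        inv_mul_cancel₀ h3]
    · refine Fin.cases ?_ (fun i => ?_) i
      · rfl
      · rw [join_val_succ]
        exact mul_inv_cancel_left₀ h3 _

theorem join_eq_join {n : ℕ} {t t' : Simp n} {r r' : unitInterval}
    (h : join n (t, r) = join n (t', r')) : r = r' ∧ (r ≠ 1 → t = t') := by
  have h0 : (r : ℝ) = r' := congrArg (fun s : Simp (n + 1) => s.1 0) h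
  obtain rfl : r = r' := Subtype.ext h0
  refine ⟨rfl, fun hr => Subtype.ext (funext fun i => ?_)⟩
  have h1 : (1 - r : ℝ) * t.1 i = (1 - r) * t'.1 i :=
    congrArg (fun s : Simp (n + 1) => s.1 i.succ) h
  refine mul_left_cancel₀ (sub_ne_zero.2 fun h => hr (Subtype.ext h.symm)) h1

theorem isQuotientMap_join (n : ℕ) : Topology.IsQuotientMap (join n) :=
  (join n).continuous.isClosedMap.isQuotientMap (join n).continuous (join_surjective n)

theorem faceMap_zero_eq_join (n : ℕ) (t : Simp n) : faceMap n 0 t = join n (t, 0) := by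
  refine Subtype.ext (funext fun i => ?_)
  refine Fin.cases ?_ (fun i => ?_) i
  · rw [faceMap_val_self]; rfl
  · rw [← Fin.succAbove_zero_apply, faceMap_val_succAbove, Fin.succAbove_zero_apply, join_val_succ]
    simp

theorem faceMap_succ_join (n : ℕ) (i : Fin (n + 2)) (t : Simp n) (r : unitInterval) :
    faceMap (n + 1) i.succ (join n (t, r)) = join (n + 1) (faceMap n i t, r) := by
  refine Subtype.ext (funext fun j => ?_)
  rcases Fin.eq_self_or_eq_succAbove i.succ j with rfl | ⟨j, rfl⟩
  · rw [faceMap_val_self, join_val_succ, faceMap_val_self, mul_zero]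
  · rw [faceMap_val_succAbove]
    refine Fin.cases ?_ (fun j => ?_) j
    · rw [Fin.succ_succAbove_zero]; rfl
    · rw [Fin.succ_succAbove_succ, join_val_succ, join_val_succ, faceMap_val_succAbove]

theorem faceMap_one_eq_join (t t' : Simp 0) : faceMap 0 1 t = join 0 (t', 1) := by
  refine Subtype.ext (funext fun i => ?_)
  have h : t.1 0 = 1 := by simpa using t.2.2
  fin_cases i
  · exact (faceMap_val_succAbove 0 1 t 0).trans h
  · refine (faceMap_val_self 0 1 t).trans ?_
    change 0 = (1 - 1 : ℝ) * _
    simp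

section Cone

variable {X : Type*} [TopologicalSpace X]

/-- The subset `V` can be contracted to a point in the set `U`. -/
def Contracts (V U : Set X) : Prop :=
  ∃ (c : X) (h : X × ℝ → X), ContinuousOn h (V ×ˢ Set.Icc 0 1) ∧
    Set.MapsTo h (V ×ˢ Set.Icc 0 1) U ∧ (∀ y ∈ V, h (y, 0) = y) ∧ ∀ y ∈ V, h (y, 1) = c

theorem Contracts.subset {V U : Set X} (h : Contracts V U) : V ⊆ U := by
  obtain ⟨c, h, -, h1, h2, -⟩ := h
  intro x hx
  rw [← h2 x hx]
  exact h1 ⟨hx, by simp⟩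

/-- (t, r) ↦ h (σ t, r) is constant at r = 1, which is all that `join` collapses, so it descends to
the simplex. Simplices outside `V` receive an irrelevant constant value. -/
theorem exists_cone {V U : Set X} {c : X} {h : X × ℝ → X}
    (hc : ContinuousOn h (V ×ˢ Set.Icc 0 1)) (hm : Set.MapsTo h (V ×ˢ Set.Icc 0 1) U)
    (h1 : ∀ y ∈ V, h (y, 1) = c) (n : ℕ) :
    ∃ κ : C(Simp n, X) → C(Simp (n + 1), X), ∀ σ : C(Simp n, X), Set.range σ ⊆ V →
      Set.range (κ σ) ⊆ U ∧ ∀ t r, κ σ (join n (t, r)) = h (σ t, r) := by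
  have key : ∀ σ : C(Simp n, X), ∃ τ : C(Simp (n + 1), X), Set.range σ ⊆ V →
      Set.range τ ⊆ U ∧ ∀ t r, τ (join n (t, r)) = h (σ t, r) := by
    intro σ
    by_cases hσ : Set.range σ ⊆ V
    · have hmem : ∀ p : Simp n × unitInterval, (σ p.1, (p.2 : ℝ)) ∈ V ×ˢ Set.Icc (0 : ℝ) 1 :=
        fun p => ⟨hσ ⟨_, rfl⟩, p.2.2⟩
      let f : C(Simp n × unitInterval, X) := ⟨fun p => h (σ p.1, p.2),
        hc.comp_continuous (by fun_prop) hmem⟩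
      have hf : Function.FactorsThrough f (join n) := by
        rintro ⟨t, r⟩ ⟨t', r'⟩ e
        obtain ⟨rfl, htt⟩ := join_eq_join e
        by_cases hr : r = 1
        · subst hr
          exact (h1 _ (hσ ⟨t, rfl⟩)).trans (h1 _ (hσ ⟨t', rfl⟩)).symm
        · rw [htt hr]
      have hτ : ∀ p, (isQuotientMap_join n).lift f hf (join n p) = f p := fun p =>
        ContinuousMap.congr_fun ((isQuotientMap_join n).lift_comp f hf) p
      refine ⟨(isQuotientMap_join n).lift f hf, fun _ => ⟨?_, fun t r => hτ _⟩⟩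
      rintro _ ⟨s, rfl⟩
      obtain ⟨p, rfl⟩ := join_surjective n s
      rw [hτ]
      exact hm (hmem p)
    · exact ⟨.const _ c, fun h => absurd h hσ⟩
  choose κ hκ using key
  exact ⟨κ, hκ⟩

/-- The cone operator satisfies ∂κ = 1 − κ∂ in positive degrees, so every cycle bounds. In degree 0
the far endpoint survives and the constant simplex at `c` spans what is left. -/
theorem Contracts.finiteRank {k : Type*} [Field k] {V U : Set X} (h : Contracts V U) (n : ℕ) :
    FiniteRank k n V U := by
  obtain ⟨c, h, hc, hm, h0, h1⟩ := h
  choose κ hκ using exists_cone hc hm h1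
  have face_zero : ∀ n (σ : C(Simp n, X)), Set.range σ ⊆ V → face n 0 (κ n σ) = σ := by
    intro n σ hσ
    refine ContinuousMap.ext fun t => ?_
    change κ n σ (faceMap n 0 t) = _
    rw [faceMap_zero_eq_join, (hκ n σ hσ).2]
    exact h0 _ (hσ ⟨t, rfl⟩)
  have face_succ : ∀ n (i : Fin (n + 2)) (σ : C(Simp (n + 1), X)), Set.range σ ⊆ V →
      face (n + 1) i.succ (κ (n + 1) σ) = κ n (face n i σ) := by
    intro n i σ hσ
    refine ContinuousMap.ext fun s => ?_
    obtain ⟨⟨t, r⟩, rfl⟩ := join_surjective n s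
    change κ (n + 1) σ (faceMap (n + 1) i.succ _) = _
    rw [faceMap_succ_join, (hκ (n + 1) σ hσ).2]
    exact ((hκ n (face n i σ) (range_comp_subset σ _ hσ)).2 t r).symm
  have face_one : ∀ σ : C(Simp 0, X), Set.range σ ⊆ V →
      face 0 1 (κ 0 σ) = ContinuousMap.const _ c := by
    intro σ hσ
    refine ContinuousMap.ext fun t => ?_
    change κ 0 σ (faceMap 0 1 t) = _
    rw [faceMap_one_eq_join t t, (hκ 0 σ hσ).2]
    exact h1 _ (hσ ⟨t, rfl⟩)
  have mem : ∀ n, ∀ x ∈ chainsIn k V n, Finsupp.lmapDomain k k (κ n) x ∈ chainsIn k U (n + 1) := by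
    intro n x hx
    rw [chainsIn, Finsupp.supported_eq_span_single] at hx
    induction hx using Submodule.span_induction with
    | zero => simp
    | add x y _ _ hx hy => rw [map_add]; exact add_mem hx hy
    | smul a x _ hx => rw [map_smul]; exact Submodule.smul_mem _ _ hx
    | mem x hx =>
      obtain ⟨σ, hσ, rfl⟩ := hx
      rw [Finsupp.lmapDomain_apply, Finsupp.mapDomain_single]
      exact Finsupp.single_mem_supported _ _ (hκ n σ hσ).1
  cases n with
  | zero =>
    refine ⟨Submodule.span k {Finsupp.single (ContinuousMap.const _ c) 1},
      Submodule.fg_span_singleton _, ?_⟩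
    rintro x ⟨-, hx⟩
    rw [SetLike.mem_coe, chainsIn, Finsupp.supported_eq_span_single] at hx
    induction hx using Submodule.span_induction with
    | zero => exact zero_mem _
    | add x y _ _ hx hy => exact add_mem hx hy
    | smul a x _ hx => exact Submodule.smul_mem _ _ hx
    | mem x hx =>
      obtain ⟨σ, hσ, rfl⟩ := hx
      refine Submodule.mem_sup.2 ⟨_, Submodule.mem_span_singleton_self _, _,
        ⟨_, mem 0 _ (Finsupp.single_mem_supported k 1 hσ), rfl⟩, ?_⟩
      rw [Finsupp.lmapDomain_apply, Finsupp.mapDomain_single, singularD_apply_single,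
        Fin.sum_univ_two, face_zero 0 σ hσ, face_one σ hσ]
      simp
  | succ n =>
    refine ⟨⊥, Submodule.fg_bot, ?_⟩
    have key : ∀ x ∈ chainsIn k V (n + 1),
        singularD k X (n + 1) (Finsupp.lmapDomain k k (κ (n + 1)) x) =
          x - Finsupp.lmapDomain k k (κ n) (singularD k X n x) := by
      intro x hx
      rw [chainsIn, Finsupp.supported_eq_span_single] at hx
      induction hx using Submodule.span_induction with
      | zero => simp
      | add x y _ _ hx hy => simp only [map_add, hx, hy]; abel
      | smul a x _ hx => simp only [map_smul, hx, smul_sub]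
      | mem x hx =>
        obtain ⟨σ, hσ, rfl⟩ := hx
        rw [Finsupp.lmapDomain_apply, Finsupp.mapDomain_single, singularD_apply_single,
          Fin.sum_univ_succ, face_zero _ σ hσ, singularD_apply_single, map_sum, sub_eq_add_neg,
          ← Finset.sum_neg_distrib]
        congr 1
        · simp
        · refine Finset.sum_congr rfl fun i _ => ?_
          rw [face_succ n i σ hσ, map_smul, Finsupp.lmapDomain_apply, Finsupp.mapDomain_single,
            Fin.val_succ, pow_succ, mul_neg_one, neg_smul]
    rintro x ⟨hx, hx'⟩
    refine Submodule.mem_sup_right ⟨_, mem (n + 1) x hx', ?_⟩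
    rw [key x hx', show singularD k X n x = 0 from hx, map_zero, sub_zero]

/-- Local contractibility of a subset. -/
def LocContr (A : Set X) : Prop :=
  ∀ x ∈ A, ∀ U, IsOpen U → x ∈ U → ∃ V, IsOpen V ∧ x ∈ V ∧ Contracts (V ∩ A) (U ∩ A)

theorem LocContr.finite_singularH {k : Type*} [Field k] [T2Space X] [CompactSpace X]
    (hX : LocContr (Set.univ : Set X)) (n : ℕ) : Module.Finite k (SingularH k X n) := by
  have hloc : ∀ n, ∀ x : X, ∀ U, IsOpen U → x ∈ U →
      ∃ V, IsOpen V ∧ x ∈ V ∧ V ⊆ U ∧ FiniteRank k n V U := by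
    intro n x U hU hx
    obtain ⟨V, hV, hxV, h⟩ := hX x trivial U hU hx
    rw [Set.inter_univ, Set.inter_univ] at h
    exact ⟨V, hV, hxV, h.subset, h.finiteRank n⟩
  obtain ⟨V, -, hV, -, h⟩ := exists_isOpen_finiteRank hloc n Set.univ Set.univ isCompact_univ
    isOpen_univ subset_rfl
  exact finite_singularH_of_finiteRank (h.mono hV subset_rfl)

end Cone

/-! ### Attaching a cell preserves local contractibility -/

section Gluing

variable {X : Type*} [TopologicalSpace X]

theorem continuousOn_of_isClosed_union {Z : Type*} [TopologicalSpace Z] {f : X → Z} {S A B : Set X}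
    (hA : IsClosed A) (hB : IsClosed B) (hS : S ⊆ A ∪ B) (fA : ContinuousOn f (S ∩ A))
    (fB : ContinuousOn f (S ∩ B)) : ContinuousOn f S := by
  have key : ∀ C : Set X, IsClosed C → ContinuousOn f (S ∩ C) →
      ∀ x ∈ S, ContinuousWithinAt f (S ∩ C) x := by
    intro C hC fC x hx
    by_cases h : x ∈ C
    · exact fC x ⟨hx, h⟩
    · refine continuousWithinAt_of_notMem_closure fun h' => h ?_
      exact closure_minimal Set.inter_subset_right hC h'
  intro x hx
  refine ((key A hA fA x hx).union (key B hB fB x hx)).mono ?_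
  rw [← Set.inter_union_distrib_left]
  exact Set.subset_inter subset_rfl hS

/-- A function on a compact image is continuous as soon as its composition is. -/
theorem continuousOn_of_isCompact {Y Z : Type*} [TopologicalSpace Y] [TopologicalSpace Z]
    [T2Space X] {K : Set Y} (hK : IsCompact K) (hK' : IsClosed K) {F : Y → X} {g : Y → Z}
    {H : X → Z} (hF : ContinuousOn F K) (hg : ContinuousOn g K) {S : Set X} (hS : S ⊆ F '' K)
    (h : ∀ a ∈ K, F a ∈ S → H (F a) = g a) : ContinuousOn H S := by
  rw [continuousOn_iff_isClosed]
  intro C hC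
  have h1 : IsClosed (K ∩ g ⁻¹' C) := hg.preimage_isClosed_of_isClosed hK' hC
  have h2 : IsCompact (K ∩ g ⁻¹' C) := hK.of_isClosed_subset h1 Set.inter_subset_left
  refine ⟨F '' (K ∩ g ⁻¹' C),
    (h2.image_of_continuousOn (hF.mono Set.inter_subset_left)).isClosed, ?_⟩
  ext x
  constructor
  · rintro ⟨hx, hxS⟩
    obtain ⟨a, ha, rfl⟩ := hS hxS
    refine ⟨⟨a, ⟨ha, ?_⟩, rfl⟩, hxS⟩
    rw [Set.mem_preimage, ← h a ha hxS]
    exact hx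
  · rintro ⟨⟨a, ⟨ha, hga⟩, rfl⟩, hxS⟩
    refine ⟨?_, hxS⟩
    rw [Set.mem_preimage, h a ha hxS]
    exact hga

theorem Contracts.mono_right {V U U' : Set X} (h : Contracts V U) (hU : U ⊆ U') :
    Contracts V U' := by
  obtain ⟨c, h, hc, hm, h0⟩ := h
  exact ⟨c, h, hc, hm.mono_right hU, h0⟩

/-- Run the deformation of `P` into `Q` at double speed, then the contraction of `Q`. -/
theorem Contracts.of_deformation {P Q U : Set X} (hQ : Contracts Q U) (H : X × ℝ → X)
    (hc : ContinuousOn H (P ×ˢ Set.Icc 0 1)) (hm : Set.MapsTo H (P ×ˢ Set.Icc 0 1) U)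
    (h0 : ∀ y ∈ P, H (y, 0) = y) (h1 : ∀ y ∈ P, H (y, 1) ∈ Q) : Contracts P U := by
  obtain ⟨c, h, gc, gm, g0, g1⟩ := hQ
  let f₁ : X × ℝ → X := fun p => H (p.1, 2 * p.2)
  let f₂ : X × ℝ → X := fun p => h (H (p.1, 1), 2 * p.2 - 1)
  let f : X × ℝ → X := fun p => if p.2 ≤ 1 / 2 then f₁ p else f₂ p
  have e₁ : ∀ p : X × ℝ, p.2 ≤ 1 / 2 → f p = f₁ p := fun p hp => if_pos hp
  have e₂ : ∀ p ∈ P ×ˢ Set.Icc (0 : ℝ) 1, 1 / 2 ≤ p.2 → f p = f₂ p := by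
    rintro ⟨x, s⟩ ⟨hx, -⟩ hp
    rcases hp.eq_or_lt with h | h
    · rw [e₁ _ h.symm.le]
      change (1 : ℝ) / 2 = s at h
      subst h
      simp only [f₁, f₂]
      norm_num
      exact (g0 _ (h1 x hx)).symm
    · exact if_neg h.not_ge
  have m₁ : Set.MapsTo (fun p : X × ℝ => (p.1, 2 * p.2))
      ((P ×ˢ Set.Icc (0 : ℝ) 1) ∩ {p | p.2 ≤ 1 / 2}) (P ×ˢ Set.Icc 0 1) := by
    rintro ⟨x, s⟩ ⟨⟨hx, hs⟩, hs'⟩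
    simp only [Set.mem_Icc, Set.mem_ofPred_eq] at hs hs'
    exact ⟨hx, by simp only [Set.mem_Icc]; constructor <;> linarith⟩
  have m₂ : Set.MapsTo (fun p : X × ℝ => (H (p.1, 1), 2 * p.2 - 1))
      ((P ×ˢ Set.Icc (0 : ℝ) 1) ∩ {p | 1 / 2 ≤ p.2}) (Q ×ˢ Set.Icc 0 1) := by
    rintro ⟨x, s⟩ ⟨⟨hx, hs⟩, hs'⟩
    simp only [Set.mem_Icc, Set.mem_ofPred_eq] at hs hs'
    exact ⟨h1 x hx, by simp only [Set.mem_Icc]; constructor <;> linarith⟩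
  refine ⟨c, f, continuousOn_of_isClosed_union (A := {p | p.2 ≤ 1 / 2}) (B := {p | 1 / 2 ≤ p.2})
    (isClosed_le continuous_snd continuous_const) (isClosed_le continuous_const continuous_snd)
    (fun p _ => le_total p.2 (1 / 2)) ?_ ?_, ?_, ?_, ?_⟩
  · refine ContinuousOn.congr (f := f₁) ?_ fun p hp => e₁ p hp.2
    exact hc.comp (Continuous.continuousOn (by fun_prop)) m₁
  · refine ContinuousOn.congr (f := f₂) ?_ fun p hp => e₂ p hp.1 hp.2
    refine gc.comp (ContinuousOn.prodMk ?_ (Continuous.continuousOn (by fun_prop))) m₂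
    refine hc.comp (Continuous.continuousOn (by fun_prop)) ?_
    rintro ⟨x, s⟩ ⟨⟨hx, hs⟩, -⟩
    exact ⟨hx, by simp⟩
  · intro p hp
    rcases le_total p.2 (1 / 2) with h | h
    · rw [e₁ p h]
      exact hm (m₁ ⟨hp, h⟩)
    · rw [e₂ p hp h]
      exact gm (m₂ ⟨hp, h⟩)
  · intro y hy
    rw [e₁ _ (by norm_num)]
    simp only [f₁, mul_zero]
    exact h0 y hy
  · intro y hy
    rw [e₂ _ ⟨hy, by simp⟩ (by norm_num)]
    simp only [f₂]
    norm_num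
    exact g1 _ (h1 y hy)

end Gluing

section Radial

variable {E : Type*} [NormedAddCommGroup E] [NormedSpace ℝ E]

/-- The radial deformation of the punctured unit ball onto the unit sphere. -/
def radial (p : E × ℝ) : E := ((1 - p.2) + p.2 * ‖p.1‖⁻¹) • p.1

theorem radial_zero (v : E) : radial (v, 0) = v := by simp [radial]

theorem radial_of_norm_eq_one {v : E} (hv : ‖v‖ = 1) (s : ℝ) : radial (v, s) = v := by
  simp [radial, hv]

theorem norm_radial {v : E} (hv : v ≠ 0) {s : ℝ} (hs : s ∈ Set.Icc (0 : ℝ) 1) :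
    ‖radial (v, s)‖ = (1 - s) * ‖v‖ + s := by
  have h1 : 0 ≤ (1 - s) + s * ‖v‖⁻¹ :=
    add_nonneg (sub_nonneg.2 hs.2) (mul_nonneg hs.1 (inv_nonneg.2 (norm_nonneg v)))
  rw [radial, norm_smul, Real.norm_of_nonneg h1, add_mul, mul_assoc,
    inv_mul_cancel₀ (norm_ne_zero_iff.2 hv), mul_one]

theorem continuousOn_radial : ContinuousOn (radial (E := E)) {p | p.1 ≠ 0} := by
  refine ContinuousOn.smul (ContinuousOn.add (Continuous.continuousOn (by fun_prop))
    (ContinuousOn.mul (Continuous.continuousOn (by fun_prop))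
      (ContinuousOn.inv₀ (Continuous.continuousOn (by fun_prop)) ?_)))
    (Continuous.continuousOn (by fun_prop))
  intro p hp
  exact norm_ne_zero_iff.2 hp

end Radial

section Attach

variable {X : Type*} [TopologicalSpace X] [T2Space X] {E : Type*} [NormedAddCommGroup E]
  [NormedSpace ℝ E] [ProperSpace E]

/-- Inside the open cell a small ball around `v` contracts along straight lines. Its neighbourhood
is cut out by removing `Y` and the image of everything outside the ball, both closed. -/
theorem exists_contracts_of_mem_ball {Y : Set X} (hY : IsClosed Y) {Φ : E → X} {ψ : X → E}
    (hΦ : ContinuousOn Φ (Metric.closedBall 0 1)) (hS : Set.MapsTo Φ (Metric.sphere 0 1) Y)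
    (hB : Disjoint Y (Φ '' Metric.ball 0 1)) (hψ : ∀ v ∈ Metric.ball (0 : E) 1, ψ (Φ v) = v)
    {U : Set X} (hU : IsOpen U) {v : E} (hv : v ∈ Metric.ball (0 : E) 1) (hvU : Φ v ∈ U) :
    ∃ V, IsOpen V ∧ Φ v ∈ V ∧ Contracts (V ∩ (Y ∪ Φ '' Metric.closedBall 0 1))
      (U ∩ (Y ∪ Φ '' Metric.closedBall 0 1)) := by
  have hΦv : ContinuousAt Φ v :=
    hΦ.continuousAt (Filter.mem_of_superset (Metric.isOpen_ball.mem_nhds hv)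
      Metric.ball_subset_closedBall)
  obtain ⟨ε, hε, hεsub⟩ := Metric.nhds_basis_closedBall.mem_iff.1
    (Filter.inter_mem (Metric.isOpen_ball.mem_nhds hv) (hΦv (hU.mem_nhds hvU)))
  have hεB : Metric.closedBall v ε ⊆ Metric.ball 0 1 := fun w hw => (hεsub hw).1
  have hεU : ∀ w ∈ Metric.closedBall v ε, Φ w ∈ U := fun w hw => (hεsub hw).2
  have hT : IsClosed (Φ '' (Metric.closedBall 0 1 \ Metric.ball v ε)) :=
    (((isCompact_closedBall (0 : E) 1).diff Metric.isOpen_ball).image_of_continuousOn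
      (hΦ.mono Set.sdiff_subset)).isClosed
  have hdisj : ∀ w ∈ Metric.ball (0 : E) 1, Φ w ∉ Y := fun w hw h =>
    Set.disjoint_left.1 hB h ⟨w, hw, rfl⟩
  have hP : ∀ y ∈ (Y ∪ Φ '' (Metric.closedBall 0 1 \ Metric.ball v ε))ᶜ ∩
      (Y ∪ Φ '' Metric.closedBall 0 1), ∃ w ∈ Metric.closedBall v ε, Φ w = y := by
    rintro y ⟨hy, hy'⟩
    rcases hy' with h | ⟨w, hw, rfl⟩
    · exact absurd (Or.inl h) hy
    · by_contra hcon
      exact hy (Or.inr ⟨w, ⟨hw, fun h => hcon ⟨w, Metric.ball_subset_closedBall h, rfl⟩⟩, rfl⟩)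
  have hline : Set.MapsTo (fun p : E × ℝ => (1 - p.2) • p.1 + p.2 • v)
      (Metric.closedBall v ε ×ˢ Set.Icc 0 1) (Metric.closedBall v ε) := by
    rintro ⟨w, s⟩ ⟨hw, hs⟩
    exact (convex_closedBall v ε) hw (Metric.mem_closedBall_self hε.le) (sub_nonneg.2 hs.2) hs.1
      (by ring)
  refine ⟨(Y ∪ Φ '' (Metric.closedBall 0 1 \ Metric.ball v ε))ᶜ, (hY.union hT).isOpen_compl, ?_,
    Φ v, fun p => Φ ((1 - p.2) • ψ p.1 + p.2 • v), ?_, ?_, ?_, ?_⟩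
  · rintro (h | ⟨w, ⟨hw, hw'⟩, hwv⟩)
    · exact hdisj v hv h
    · rcases (Metric.mem_closedBall.1 hw).lt_or_eq with h | h
      · have := hψ w h
        rw [hwv, hψ v hv] at this
        subst this
        exact hw' (Metric.mem_ball_self hε)
      · exact hdisj v hv (hwv ▸ hS h)
  · refine continuousOn_of_isCompact (K := Metric.closedBall v ε ×ˢ Set.Icc (0 : ℝ) 1)
      (F := fun p => (Φ p.1, p.2)) (g := fun p => Φ ((1 - p.2) • p.1 + p.2 • v))
      ((isCompact_closedBall v ε).prod isCompact_Icc)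
      (Metric.isClosed_closedBall.prod isClosed_Icc) ?_ ?_ ?_ ?_
    · refine ContinuousOn.prodMk (hΦ.comp continuousOn_fst ?_) continuousOn_snd
      rintro ⟨w, s⟩ ⟨hw, -⟩
      exact Metric.ball_subset_closedBall (hεB hw)
    · refine hΦ.comp (Continuous.continuousOn (by fun_prop)) ?_
      exact fun p hp => Metric.ball_subset_closedBall (hεB (hline hp))
    · rintro ⟨y, s⟩ ⟨hy, hs⟩
      obtain ⟨w, hw, rfl⟩ := hP y hy
      exact ⟨(w, s), ⟨hw, hs⟩, rfl⟩
    · rintro ⟨w, s⟩ ⟨hw, -⟩ -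
      simp only [hψ w (hεB hw)]
  · rintro ⟨y, s⟩ ⟨hy, hs⟩
    obtain ⟨w, hw, rfl⟩ := hP y hy
    have := hline (x := (w, s)) ⟨hw, hs⟩
    simp only [hψ w (hεB hw)]
    exact ⟨hεU _ this, Or.inr ⟨_, Metric.ball_subset_closedBall (hεB this), rfl⟩⟩
  · intro y hy
    obtain ⟨w, hw, rfl⟩ := hP y hy
    simp [hψ w (hεB hw)]
  · intro y hy
    simp

/-- Near `Y` the cell is pushed radially onto its boundary, which lands in `Y`; after that the
contraction given for `Y` applies. The neighbourhood removes the image of the compact set `T` of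
points near the centre, leaving `U` on the way, or ending outside `V₀`. -/
theorem exists_contracts_of_mem {Y : Set X} (hY : IsClosed Y) (hLC : LocContr Y) {Φ : E → X}
    {ψ : X → E} (hΦ : ContinuousOn Φ (Metric.closedBall 0 1))
    (hS : Set.MapsTo Φ (Metric.sphere 0 1) Y) (hB : Disjoint Y (Φ '' Metric.ball 0 1))
    (hψ : ∀ v ∈ Metric.ball (0 : E) 1, ψ (Φ v) = v) {U : Set X} (hU : IsOpen U) {x : X}
    (hx : x ∈ Y) (hxU : x ∈ U) :
    ∃ V, IsOpen V ∧ x ∈ V ∧ Contracts (V ∩ (Y ∪ Φ '' Metric.closedBall 0 1))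
      (U ∩ (Y ∪ Φ '' Metric.closedBall 0 1)) := by
  classical
  obtain ⟨V₀, hV₀, hxV₀, hcontr⟩ := hLC x hx U hU hxU
  let R : Set E := Metric.closedBall 0 1 \ Metric.ball 0 (1 / 2)
  have hR : IsCompact R := (isCompact_closedBall 0 1).diff Metric.isOpen_ball
  have hR1 : ∀ w ∈ R, ‖w‖ ≤ 1 := fun w hw => mem_closedBall_zero_iff.1 hw.1
  have hR0 : ∀ w ∈ R, w ≠ 0 := by
    rintro w hw rfl
    exact hw.2 (Metric.mem_ball_self (by norm_num))
  have hRI : IsCompact (R ×ˢ Set.Icc (0 : ℝ) 1) := hR.prod isCompact_Icc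
  have hrad : ContinuousOn (radial (E := E)) (R ×ˢ Set.Icc (0 : ℝ) 1) :=
    continuousOn_radial.mono fun p hp => hR0 p.1 hp.1
  have hradB : Set.MapsTo (radial (E := E)) (R ×ˢ Set.Icc (0 : ℝ) 1) (Metric.closedBall 0 1) := by
    rintro ⟨w, s⟩ ⟨hw, hs⟩
    rw [mem_closedBall_zero_iff, norm_radial (hR0 w hw) hs]
    have h1 := hR1 w hw
    have h2 := mul_le_mul_of_nonneg_left h1 (sub_nonneg.2 hs.2)
    linarith
  have hΦrad : ContinuousOn (fun p => Φ (radial p)) (R ×ˢ Set.Icc (0 : ℝ) 1) := hΦ.comp hrad hradB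
  have h1I : (1 : ℝ) ∈ Set.Icc (0 : ℝ) 1 := by simp
  have hradS : ∀ w ∈ R, radial (w, 1) ∈ Metric.sphere (0 : E) 1 := by
    intro w hw
    rw [mem_sphere_zero_iff_norm, norm_radial (hR0 w hw) h1I]
    ring
  have hΦrad1 : ContinuousOn (fun w => Φ (radial (w, 1))) R :=
    hΦrad.comp (Continuous.continuousOn (by fun_prop)) fun w hw => ⟨hw, h1I⟩
  -- the points of the ball that are not close to the sphere, or not pushed into `V₀` inside `U`
  let T : Set E := Metric.closedBall 0 (1 / 2) ∪
    (Prod.fst '' ((R ×ˢ Set.Icc (0 : ℝ) 1) ∩ (fun p => Φ (radial p)) ⁻¹' Uᶜ) ∪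
      R ∩ (fun w => Φ (radial (w, 1))) ⁻¹' V₀ᶜ)
  have hTc : IsCompact T := by
    refine (isCompact_closedBall _ _).union (IsCompact.union (IsCompact.image ?_ continuous_fst) ?_)
    · exact hRI.of_isClosed_subset (hΦrad.preimage_isClosed_of_isClosed hRI.isClosed
        hU.isClosed_compl) Set.inter_subset_left
    · exact hR.of_isClosed_subset (hΦrad1.preimage_isClosed_of_isClosed hR.isClosed
        hV₀.isClosed_compl) Set.inter_subset_left
  have hTB : T ⊆ Metric.closedBall 0 1 := by
    refine Set.union_subset (Metric.closedBall_subset_closedBall (by norm_num))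
      (Set.union_subset ?_ fun w hw => hw.1.1)
    rintro _ ⟨p, hp, rfl⟩
    exact hp.1.1.1
  have hT : ∀ w ∈ Metric.closedBall (0 : E) 1, w ∉ T → w ∈ R ∧
      (∀ s ∈ Set.Icc (0 : ℝ) 1, Φ (radial (w, s)) ∈ U) ∧ Φ (radial (w, 1)) ∈ V₀ := by
    intro w hw hwT
    have hwR : w ∈ R := ⟨hw, fun h => hwT (Or.inl (Metric.ball_subset_closedBall h))⟩
    refine ⟨hwR, fun s hs => ?_, ?_⟩
    · by_contra h
      exact hwT (Or.inr (Or.inl ⟨(w, s), ⟨⟨hwR, hs⟩, h⟩, rfl⟩))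
    · by_contra h
      exact hwT (Or.inr (Or.inr ⟨hwR, h⟩))
  have hsphere : ∀ w ∈ Metric.closedBall (0 : E) 1, Φ w ∈ Y → ‖w‖ = 1 := by
    intro w hw hwY
    rcases (mem_closedBall_zero_iff.1 hw).lt_or_eq with h | h
    · exact absurd ⟨w, mem_ball_zero_iff.2 h, rfl⟩ (Set.disjoint_left.1 hB hwY)
    · exact h
  let V : Set X := (Y \ V₀ ∪ Φ '' T)ᶜ
  have hVT : ∀ w ∈ Metric.closedBall (0 : E) 1, Φ w ∈ V → w ∉ T := fun w _ hwV h =>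
    hwV (Or.inr ⟨w, h, rfl⟩)
  have hVY : ∀ y ∈ V, y ∈ Y → y ∈ V₀ := by
    intro y hy hyY
    by_contra h
    exact hy (Or.inl ⟨hyY, h⟩)
  let H : X × ℝ → X := fun p => if p.1 ∈ Y then p.1 else Φ (radial (ψ p.1, p.2))
  have HY : ∀ y ∈ Y, ∀ s, H (y, s) = y := fun y hy s => if_pos hy
  have HΦ : ∀ w ∈ Metric.closedBall (0 : E) 1, ∀ s, H (Φ w, s) = Φ (radial (w, s)) := by
    intro w hw s
    by_cases h : Φ w ∈ Y
    · rw [HY _ h, radial_of_norm_eq_one (hsphere w hw h)]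
    · have h1 : w ∈ Metric.ball (0 : E) 1 := by
        rcases (mem_closedBall_zero_iff.1 hw).lt_or_eq with h' | h'
        · exact mem_ball_zero_iff.2 h'
        · exact absurd (hS (mem_sphere_zero_iff_norm.2 h')) h
      refine (if_neg h).trans ?_
      rw [hψ w h1]
  refine ⟨V, ?_, ?_, ?_⟩
  · exact ((hY.sdiff hV₀).union (hTc.image_of_continuousOn (hΦ.mono hTB)).isClosed).isOpen_compl
  · rintro (h | ⟨w, hw, rfl⟩)
    · exact h.2 hxV₀
    · have h1 := hsphere w (hTB hw) hx
      rcases hw with hw | ⟨⟨w, s⟩, ⟨-, hs⟩, rfl⟩ | hw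
      · rw [mem_closedBall_zero_iff, h1] at hw
        norm_num at hw
      · refine hs ?_
        change Φ (radial (w, s)) ∈ U
        rwa [radial_of_norm_eq_one h1]
      · refine hw.2 ?_
        change Φ (radial (w, 1)) ∈ V₀
        rwa [radial_of_norm_eq_one h1]
  · refine (hcontr.mono_right (Set.inter_subset_inter_right U Set.subset_union_left)).of_deformation
      H ?_ ?_ ?_ ?_
    · refine continuousOn_of_isClosed_union (A := Y ×ˢ Set.univ)
        (B := (Φ '' Metric.closedBall 0 1) ×ˢ Set.univ) (hY.prod isClosed_univ)
        (((isCompact_closedBall 0 1).image_of_continuousOn hΦ).isClosed.prod isClosed_univ)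
        ?_ ?_ ?_
      · rintro ⟨y, s⟩ ⟨⟨-, hy⟩, -⟩
        exact hy.imp (fun h => ⟨h, trivial⟩) fun h => ⟨h, trivial⟩
      · exact continuousOn_fst.congr fun p hp => HY p.1 hp.2.1 p.2
      · refine continuousOn_of_isCompact hRI hRI.isClosed (F := fun p => (Φ p.1, p.2))
          (g := fun p => Φ (radial p)) ?_ hΦrad ?_ ?_
        · exact ContinuousOn.prodMk (hΦ.comp continuousOn_fst fun p hp => hp.1.1) continuousOn_snd
        · rintro ⟨_, s⟩ ⟨⟨⟨hV, -⟩, hs⟩, ⟨⟨w, hw, rfl⟩, -⟩⟩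
          exact ⟨(w, s), ⟨(hT w hw (hVT w hw hV)).1, hs⟩, rfl⟩
        · rintro ⟨w, s⟩ ⟨hw, -⟩ -
          exact HΦ w hw.1 s
    · rintro ⟨y, s⟩ ⟨⟨hyV, hy⟩, hs⟩
      rcases hy with hy | ⟨w, hw, rfl⟩
      · rw [HY y hy]
        exact ⟨(hcontr.subset ⟨hVY y hyV hy, hy⟩).1, Or.inl hy⟩
      · rw [HΦ w hw]
        obtain ⟨h1, h2, -⟩ := hT w hw (hVT w hw hyV)
        exact ⟨h2 s hs, Or.inr ⟨_, hradB ⟨h1, hs⟩, rfl⟩⟩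
    · rintro y ⟨-, hy | ⟨w, hw, rfl⟩⟩
      · exact HY y hy 0
      · rw [HΦ w hw, radial_zero]
    · rintro y ⟨hyV, hy | ⟨w, hw, rfl⟩⟩
      · rw [HY y hy]
        exact ⟨hVY y hyV hy, hy⟩
      · rw [HΦ w hw]
        obtain ⟨h1, -, h2⟩ := hT w hw (hVT w hw hyV)
        exact ⟨h2, hS (hradS w h1)⟩

/-- Attaching a cell to a closed locally contractible subset yields a locally contractible
subset. -/
theorem LocContr.union_image_closedBall {Y : Set X} (hY : IsClosed Y) (hLC : LocContr Y) {Φ : E → X}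
    {ψ : X → E} (hΦ : ContinuousOn Φ (Metric.closedBall 0 1))
    (hS : Set.MapsTo Φ (Metric.sphere 0 1) Y) (hB : Disjoint Y (Φ '' Metric.ball 0 1))
    (hψ : ∀ v ∈ Metric.ball (0 : E) 1, ψ (Φ v) = v) :
    LocContr (Y ∪ Φ '' Metric.closedBall 0 1) := by
  intro x hx U hU hxU
  by_cases hxY : x ∈ Y
  · exact exists_contracts_of_mem hY hLC hΦ hS hB hψ hU hxY hxU
  · obtain ⟨v, hv, rfl⟩ := hx.resolve_left hxY
    have hv' : v ∈ Metric.ball (0 : E) 1 := by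
      rcases (Metric.mem_closedBall.1 hv).lt_or_eq with h | h
      · exact h
      · exact absurd (hS h) hxY
    exact exists_contracts_of_mem_ball hY hΦ hS hB hψ hU hv' hxU

end Attach

/-! ### Compact CW complexes have finitely many cells and are locally contractible -/

section CWComplex

open Topology CWComplex

variable {X : Type*} [TopologicalSpace X] [T2Space X] [CWComplex (Set.univ : Set X)]

/-- Choose the centre of each cell. A closed cell meets finitely many open cells, so every set of
centres is closed; the centres thus form a closed discrete subset of a compact space. -/
theorem finite_cells [CompactSpace X] : Finite (Σ n, cell (Set.univ : Set X) n) := by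
  classical
  let ctr : (Σ n, cell (Set.univ : Set X) n) → X := fun e => map e.1 e.2 0
  have hctr : ∀ e, ctr e ∈ openCell e.1 e.2 := fun e => map_zero_mem_openCell e.1 e.2
  have huniq : ∀ e e' : Σ n, cell (Set.univ : Set X) n, ctr e ∈ openCell e'.1 e'.2 → e = e' := by
    intro e e' h
    by_contra hne
    exact Set.disjoint_left.1 (disjoint_openCell_of_ne hne) (hctr e) h
  have hinj : Function.Injective ctr := fun e e' h => huniq e e' (h ▸ hctr e')
  have hclosed : ∀ s : Set (Σ n, cell (Set.univ : Set X) n), IsClosed (ctr '' s) := by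
    intro s
    rw [CWComplex.closed Set.univ _ (Set.subset_univ _)]
    intro n j
    obtain ⟨I, hI⟩ := CWComplex.cellFrontier_subset_finite_openCell n j
    refine Set.Finite.isClosed (Set.Finite.subset (s := ctr '' (insert ⟨n, j⟩
      ((Finset.range n).sigma I : Set (Σ n, cell (Set.univ : Set X) n)))) ?_ ?_)
    · exact (Set.Finite.insert _ (Finset.finite_toSet _)).image _
    · rintro _ ⟨⟨e, -, rfl⟩, he⟩
      refine ⟨e, ?_, rfl⟩
      rw [← cellFrontier_union_openCell_eq_closedCell] at he
      rcases he with he | he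
      · have := hI he
        simp only [Set.mem_iUnion] at this
        obtain ⟨m, hm, i, hi, he⟩ := this
        rw [huniq e ⟨m, i⟩ he]
        exact Or.inr (Finset.mem_coe.2 (Finset.mem_sigma.2 ⟨Finset.mem_range.2 hm, hi⟩))
      · exact Or.inl (huniq e ⟨n, j⟩ he)
  let _ : TopologicalSpace (Σ n, cell (Set.univ : Set X) n) := ⊥
  have : DiscreteTopology (Σ n, cell (Set.univ : Set X) n) := ⟨rfl⟩
  have hemb : IsClosedEmbedding ctr :=
    .of_continuous_injective_isClosedMap continuous_of_discreteTopology hinj fun s _ => hclosed s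
  have := hemb.compactSpace
  exact finite_of_compact_of_discrete

theorem locContr_skeletonLT_union [CompactSpace X] (n : ℕ)
    (h : LocContr (skeletonLT (Set.univ : Set X) n : Set X))
    (J : Finset (cell (Set.univ : Set X) n)) :
    LocContr ((skeletonLT (Set.univ : Set X) n : Set X) ∪ ⋃ j ∈ J, closedCell n j) := by
  classical
  induction J using Finset.induction_on with
  | empty => simpa using h
  | insert j J hj ih =>
    have e : (skeletonLT (Set.univ : Set X) n : Set X) ∪ ⋃ i ∈ insert j J, closedCell n i =
        ((skeletonLT (Set.univ : Set X) n : Set X) ∪ ⋃ i ∈ J, closedCell n i) ∪ closedCell n j := by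
      rw [Finset.set_biUnion_insert, Set.union_assoc, Set.union_comm (closedCell n j)]
    rw [e]
    refine ih.union_image_closedBall ?_ (ψ := (map n j).symm) (continuousOn n j) ?_ ?_ ?_
    · exact (skeletonLT (Set.univ : Set X) n).closed.union
        (J.finite_toSet.isClosed_biUnion fun i _ => isClosed_closedCell)
    · intro v hv
      exact Or.inl (cellFrontier_subset_skeletonLT n j ⟨v, hv, rfl⟩)
    · refine Set.disjoint_union_left.2 ⟨disjoint_skeletonLT_openCell le_rfl, ?_⟩
      simp only [Set.disjoint_iUnion_left]
      intro i hi
      change Disjoint (closedCell n i) (openCell n j)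
      rw [← cellFrontier_union_openCell_eq_closedCell]
      refine Set.disjoint_union_left.2 ⟨?_, ?_⟩
      · exact (disjoint_skeletonLT_openCell (n := n) le_rfl).mono_left
          (cellFrontier_subset_skeletonLT n i)
      · refine disjoint_openCell_of_ne fun h => hj ?_
        obtain ⟨-, h⟩ := Sigma.mk.inj_iff.1 h
        rwa [← eq_of_heq h]
    · intro v hv
      exact (map n j).left_inv (by rwa [source_eq])

/-- A compact CW complex is locally contractible. -/
theorem locContr_univ [CompactSpace X] : LocContr (Set.univ : Set X) := by
  have hfin : Finite (Σ n, cell (Set.univ : Set X) n) := finite_cells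
  have key : ∀ n : ℕ, LocContr (skeletonLT (Set.univ : Set X) n : Set X) := by
    intro n
    induction n with
    | zero =>
      intro x hx
      have : x ∈ (∅ : Set X) := by
        rw [← CWComplex.skeletonLT_zero_eq_empty (C := Set.univ)]
        exact hx
      exact absurd this (Set.notMem_empty x)
    | succ n ih =>
      have : Finite (cell (Set.univ : Set X) n) :=
        Finite.of_injective (Sigma.mk n) sigma_mk_injective
      have := Fintype.ofFinite (cell (Set.univ : Set X) n)
      have h := locContr_skeletonLT_union n ih Finset.univ
      simp only [Finset.mem_univ, Set.iUnion_true] at h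
      rw [skeletonLT_union_iUnion_closedCell_eq_skeletonLT_succ] at h
      exact_mod_cast h
  obtain ⟨N, hN⟩ := (Set.finite_range
    (fun e : Σ n, cell (Set.univ : Set X) n => e.1)).bddAbove
  -- `skeletonLT` is strict, so cells of dimension at most `N` need N + 1.
  have huniv : (skeletonLT (Set.univ : Set X) (N + 1 : ℕ) : Set X) = Set.univ := by
    refine Set.eq_univ_of_forall fun x => ?_
    have hx : x ∈ ⋃ (n : ℕ) (j : cell (Set.univ : Set X) n), openCell n j := by
      rw [iUnion_openCell_eq_complex]; trivial
    simp only [Set.mem_iUnion] at hx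
    obtain ⟨n, j, hx⟩ := hx
    refine CWComplex.mem_skeletonLT_iff.2 ⟨n, ?_, j, hx⟩
    exact_mod_cast Nat.lt_succ_of_le (hN ⟨⟨n, j⟩, rfl⟩)
  exact huniv ▸ key (N + 1)

end CWComplex

/-! ### Towers of covers -/

section Tower

/-- The image of `q` is open, and closed because a fibre meeting an evenly covered neighbourhood
forces the central fibre to be nonempty. By connectedness `q` is onto, and path-connectedness
descends. -/
theorem pathConnectedSpace_of_isCoverAssociatedTo {E X : Type*} [TopologicalSpace E]
    [TopologicalSpace X] [ConnectedSpace X] {q : C(E, X)} {x₀ : X}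
    {K : Subgroup (FundamentalGroup X x₀)} (h : IsCoverAssociatedTo q K) :
    PathConnectedSpace X := by
  have := h.pathConnectedSpace
  have hopen : IsOpen (Set.range q) := h.isCoveringMap.isLocalHomeomorph.isOpenMap.isOpen_range
  have hclosed : IsClosed (Set.range q) := by
    rw [← isOpen_compl_iff, isOpen_iff_mem_nhds]
    intro x hx
    obtain ⟨-, U, hxU, hU, -, φ, -⟩ := h.isCoveringMap x
    refine Filter.mem_of_superset (hU.mem_nhds hxU) ?_
    rintro _ hyU ⟨e, rfl⟩
    exact hx ⟨_, (φ ⟨e, hyU⟩).2.2⟩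
  have hsurj : Function.Surjective q := by
    rw [← Set.range_eq_univ]
    exact IsClopen.eq_univ ⟨hclosed, hopen⟩ (Set.range_nonempty q)
  exact hsurj.pathConnectedSpace q.continuous

variable {k : Type*} [Field k] {p : ℕ} [Fact p.Prime] [CharP k p] {X : Type*} [TopologicalSpace X]
  [ConnectedSpace X] {x₀ : X} {K : Subgroup (FundamentalGroup X x₀)} {n : ℕ}

theorem index_ne_zero_of_eq_pow {G : Type*} [Group G] {K : Subgroup G} {m : ℕ}
    (hK : K.index = p ^ m) : K.index ≠ 0 := by
  rw [hK]
  exact pow_ne_zero _ (Fact.out : p.Prime).ne_zero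

theorem finite_homology_of_cover [K.Normal] {m : ℕ} (hK : K.index = p ^ m) {E : Type*}
    [TopologicalSpace E] {q : C(E, X)} (h : IsCoverAssociatedTo q K)
    [Module.Finite k (SingularH k X n)] : Module.Finite k (homology k n E) := by
  have := pathConnectedSpace_of_isCoverAssociatedTo h
  have : Finite (FundamentalGroup X x₀ ⧸ K) :=
    Nat.finite_of_card_ne_zero (index_ne_zero_of_eq_pow hK)
  have := finite_singularH_of_cover (k := k)
    (fun x => Path.Homotopic.Quotient.mk (PathConnectedSpace.somePath x₀ x))
    (IsPGroup.of_card hK) h n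
  exact Module.Finite.equiv (singularEquiv n).symm

/-- The normalized Betti numbers decrease along a tower of covers of `p`-power degree. -/
theorem bettiNumber_div_index_le {K' : Subgroup (FundamentalGroup X x₀)} [K.Normal] [K'.Normal]
    {m : ℕ} (hK' : K'.index = p ^ m) (hle : K' ≤ K) {E E' : Type*} [TopologicalSpace E]
    [TopologicalSpace E'] {q : C(E, X)} {q' : C(E', X)} (h : IsCoverAssociatedTo q K)
    (h' : IsCoverAssociatedTo q' K') [Module.Finite k (homology k n E)] :
    (bettiNumber k n E' : ℝ) / K'.index ≤ (bettiNumber k n E : ℝ) / K.index := by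
  have := pathConnectedSpace_of_isCoverAssociatedTo h
  have hmul : K'.relIndex K * K.index = K'.index := Subgroup.relIndex_mul_index hle
  have hne : K'.relIndex K * K.index ≠ 0 := hmul ▸ index_ne_zero_of_eq_pow hK'
  -- [K : K'] divides the `p`-power index of `K'`, so K/K' is a `p`-group.
  obtain ⟨l, -, hl⟩ := (Nat.dvd_prime_pow (Fact.out : p.Prime)).1
    (hK' ▸ Dvd.intro _ hmul : K'.relIndex K ∣ p ^ m)
  have : Finite (K ⧸ K'.subgroupOf K) := Nat.finite_of_card_ne_zero (left_ne_zero_of_mul hne)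
  have : Module.Finite k (SingularH k E n) := Module.Finite.equiv (singularEquiv n)
  have key := finrank_singularH_le_of_covers (k := k)
    (fun x => Path.Homotopic.Quotient.mk (PathConnectedSpace.somePath x₀ x)) hle
    (IsPGroup.of_card hl) h h' n
  rw [← (singularEquiv (k := k) n).finrank_eq, ← (singularEquiv (k := k) n).finrank_eq] at key
  change bettiNumber k n E' ≤ K'.relIndex K * bettiNumber k n E at key
  have hpos : (0 : ℝ) < K'.relIndex K :=
    Nat.cast_pos.2 (Nat.pos_of_ne_zero (left_ne_zero_of_mul hne))
  rw [← hmul, Nat.cast_mul, ← div_div]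
  refine div_le_div_of_nonneg_right ?_ (Nat.cast_nonneg _)
  rw [div_le_iff₀ hpos, mul_comm]
  exact_mod_cast key

end Tower

end PTower

end

theorem mainTheorem4
    -- a field of positive characteristic
    {k : Type*} [Field k] {p : ℕ} [CharP k p] (hp : 0 < p)
    -- a compact connected CW-complex (CW-complexes are Hausdorff) and its fundamental group
    {X : Type*} [TopologicalSpace X] [T2Space X] [Topology.CWComplex (Set.univ : Set X)]
    [CompactSpace X] [ConnectedSpace X] (x₀ : X)
    (Γ : ℕ → Subgroup (FundamentalGroup X x₀)) (hΓ : PTower.IsResidualPChain p Γ)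
    -- the covers of `X` associated to the subgroups in the chain
    (E : ℕ → Type*) [∀ i, TopologicalSpace (E i)] (q : ∀ i, C(E i, X))
    (hq : ∀ i, PTower.IsCoverAssociatedTo (q i) (Γ i)) (n : ℕ) :
    (∀ i, Module.Finite k (PTower.homology k n (E i))) ∧
      Antitone (fun i => (PTower.bettiNumber k n (E i) : ℝ) / ((Γ i).index : ℝ)) ∧
      ∃ L : ℝ, Filter.Tendsto
        (fun i => (PTower.bettiNumber k n (E i) : ℝ) / ((Γ i).index : ℝ))
        Filter.atTop (nhds L) := by
  have : Fact p.Prime := ⟨(CharP.char_is_prime_or_zero k p).resolve_right hp.ne'⟩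
  have := hΓ.normal
  have : Module.Finite k (PTower.SingularH k X n) := PTower.locContr_univ.finite_singularH n
  have hfin (i : ℕ) : Module.Finite k (PTower.homology k n (E i)) :=
    let ⟨_, hm⟩ := hΓ.index_eq_pow i
    PTower.finite_homology_of_cover hm (hq i)
  have hanti : Antitone
      (fun i => (PTower.bettiNumber k n (E i) : ℝ) / ((Γ i).index : ℝ)) := fun i j hij =>
    let ⟨_, hm⟩ := hΓ.index_eq_pow j
    PTower.bettiNumber_div_index_le hm (hΓ.antitone hij) (hq i) (hq j)
  -- The limit is the infimum; 0 is a lower bound.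
  exact ⟨hfin, hanti, _, tendsto_atTop_ciInf hanti
    ⟨0, Set.forall_mem_range.2 fun i => by positivity⟩⟩
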